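/- Let $q$ be a power of a prime, $A=\mathbb F_q[\theta]$, $K_\infty=\mathbb F_q((1/\theta))$ with the absolute value normalised by $|\theta|=q$, and let $\mathbb C_\infty$ be the completion of an algebraic closure of $K_\infty$. Let $\mathbb T\subset\mathbb C_\infty[[t]]$ be the Tate algebra of series converging on $|t|\le 1$, and for $f=\sum a_it^i$ put $f^{(1)}=\sum a_i^qt^i$. Fix a $(q-1)$-th root of $-\theta$ and put $$\Omega=(-\theta)^{-q/(q-1)}\prod_{i\ge1}\Bigl(1-\frac{t}{\theta^{q^i}}\Bigr),\qquad \tilde\pi=\frac1{\Omega(\theta)}.$$ Let $L_0=1$, $L_i=(\theta-\theta^q)\cdots(\theta-\theta^{q^i})$, and for $d\ge1$ and positive integers $n_1,\dots,n_d$ let $$\mathrm{Li}_{n_1,\dots,n_d}(z_1,\dots,z_d)=\sum_{0\le i_1<\cdots<i_d}\frac{z_1^{q^{i_1}}\cdots z_d^{q^{i_d}}}{L_{i_1}^{n_1}\cdots L_{i_d}^{n_d}}$$ be the Carlitz multiple polylogarithm. Let $\mathbb D\subset\mathbb C_\infty^d$ be the set of $(z_1,\dots,z_d)$ with $\prod_{k}\bigl(|z_k|/|\theta|^{qn_k/(q-1)}\bigr)^{q^{i_k}}\to0$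 as $0\le i_1<\cdots<i_d\to\infty$. For $Z_1,\dots,Z_k\in\mathbb T$, a *solution for* $(Z_1,\dots,Z_k)$ is a tuple $(f_1,\dots,f_k)\in\mathbb T^k$ such that, with $f_0=1$, $f_i-f_i^{(1)}=Z_{k-i+1}f_{i-1}^{(1)}$ for $1\le i\le k$. Put $N=n_1+\cdots+n_d$ and fix $z_1,\dots,z_{d-1}\in\mathbb C_\infty$. Let $\mathbb M\subset\mathbb T^d$ be $\Omega^{-N}$ times the $\mathbb F_q[t]$-module generated by the vectors $(0,\dots,0,1,f_1,\dots,f_k)$, where $0\le k\le d-1$ and $(f_1,\dots,f_k)$ runs over the solutions for $(\Omega^{n_1}z_1,\dots,\Omega^{n_k}z_k)$. The monodromy module $M\subset\mathbb C_\infty^d$ is the $A$-module obtained by evaluating $\mathbb M$ at $t=\theta$. The continued Carlitz multiple polylogarithm $$\vec{\mathrm{Li}}_{n_1,\dots,n_d}(z_1,\dots,z_{d-1},-):\mathbb C_\infty\to\mathbb C_\infty^d/M$$ sends $z_d$ to the class of $\bigl(\Omega^{-N}(f_1,\dots,f_d)\bigr)\big|_{t=\theta}$, where $(f_1,\dots,f_d)$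 is a solution for $(\Omega^{n_1}z_1,\dots,\Omega^{n_d}z_d)$. Then the following hold. (0) All elements of $\mathbb M$ converge at $t=\theta$. The map $\vec{\mathrm{Li}}_{n_1,\dots,n_d}(z_1,\dots,z_{d-1},-)$ is well defined and $\mathbb F_q$-linear, and the values $\bigl(\Omega^{-N}(f_1,\dots,f_d)\bigr)|_{t=\theta}$ over all solutions that converge at $t=\theta$ form exactly one coset of $M$. (1) Let $(z_1,\dots,z_d)\in\mathbb D$. Then the series $\mathrm{Li}_{n_1,\dots,n_d}(z_1,\dots,z_d)$ converges, and if $z_1,\dots,z_{d-1}$ are all nonzero then $\mathrm{Li}_{n_k,\dots,n_d}(z_k,\dots,z_d)$ converges for every $1\le k\le d$. Whenever these series all converge, $$\vec{\mathrm{Li}}_{n_1,\dots,n_d}(z_1,\dots,z_d)\equiv\bigl(\tilde\pi^{n_1+\cdots+n_{d-1}}\mathrm{Li}_{n_d}(z_d),\ \dots,\ \tilde\pi^{n_1}\mathrm{Li}_{n_2,\dots,n_d}(z_2,\dots,z_d),\ \mathrm{Li}_{n_1,\dots,n_d}(z_1,\dots,z_d)\bigr)\bmod M.$$ (2) $\vec{\mathrm{Li}}_{n_1,\dots,n_d}(z_1,\dots,z_{d-1},-)$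 is locally rigid-analytic: for every $x_0\in\mathbb C_\infty$ there are a closed disk $U\ni x_0$ in $\mathbb C_\infty$ and a closed polydisk $V\subset\mathbb C_\infty^d$ that injects into $\mathbb C_\infty^d/M$ and whose image contains $\vec{\mathrm{Li}}_{n_1,\dots,n_d}(z_1,\dots,z_{d-1},U)$, such that each coordinate of the induced map $U\to V$ is a rigid analytic function, i.e. is given on $U$ by a power series $\sum_k a_k(x-x_0)^k$ with $|a_k|r^k\to0$, where $r>0$ is the radius of $U$. (3) $M$ is discrete in $\mathbb C_\infty^d$. -/

import Mathlib

open Filter Topology Polynomial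
open scoped PowerSeries NNReal WithZero

noncomputable section

namespace CarlitzMPL

/-! ### The fields `K_∞ ⊆ K̄_∞ ⊆ ℂ_∞` -/

section Fields

variable (F : Type*) [Field F] [Fintype F]

set_option linter.unusedSectionVars false

/-- `K_∞ = 𝔽_q((1/θ))`: Laurent series over `𝔽_q` in the variable `1/θ`. -/
def KInf : Type _ := LaurentSeries F

namespace KInf

instance : Field (KInf F) := inferInstanceAs (Field (LaurentSeries F))
instance : Algebra F (KInf F) := inferInstanceAs (Algebra F (LaurentSeries F))
instance : Valued (KInf F) ℤᵐ⁰ := inferInstanceAs (Valued (LaurentSeries F) ℤᵐ⁰)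
instance : CompleteSpace (KInf F) := inferInstanceAs (CompleteSpace (LaurentSeries F))

/-- The element `θ`, the inverse of the Laurent series variable. -/
def theta : KInf F := (HahnSeries.single (-1 : ℤ) (1 : F) : LaurentSeries F)

theorem v_theta : Valued.v (theta F) = WithZero.exp (1 : ℤ) := by
  have h := LaurentSeries.valuation_single_zpow F (-1)
  rw [neg_neg] at h
  exact h

theorem one_lt_q : (1 : ℝ≥0) < (Fintype.card F : ℝ≥0) := by
  exact_mod_cast Fintype.one_lt_card (α := F)

/-- The `∞`-adic valuation has rank one; `exp k` is sent to the real number `q ^ k`. -/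
instance : Valuation.RankOne (Valued.v : Valuation (KInf F) ℤᵐ⁰) where
  hom' := (WithZeroMulInt.toNNReal (one_lt_q F).ne_zero).comp
    MonoidWithZeroHom.ValueGroup₀.embedding
  strictMono' := (WithZeroMulInt.toNNReal_strictMono (one_lt_q F)).comp
    MonoidWithZeroHom.ValueGroup₀.embedding_strictMono
  exists_val_nontrivial := ⟨theta F, by rw [v_theta]; simp, by rw [v_theta]; decide⟩

/-- The absolute value on `K_∞`, normalised by `|θ| = q`. -/
instance : NontriviallyNormedField (KInf F) := Valued.toNontriviallyNormedField (KInf F) ℤᵐ⁰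

instance : IsUltrametricDist (KInf F) := Valued.instIsUltrametricDist (KInf F) ℤᵐ⁰

theorem norm_theta : ‖theta F‖ = Fintype.card F := by
  have h : ‖theta F‖ = ((WithZeroMulInt.toNNReal (one_lt_q F).ne_zero
      (MonoidWithZeroHom.ValueGroup₀.embedding
        ((Valued.v : Valuation (KInf F) ℤᵐ⁰).restrict (theta F))) : ℝ≥0) : ℝ) := rfl
  rw [h, Valuation.embedding_restrict, v_theta,
    WithZeroMulInt.toNNReal_neg_apply _ (WithZero.exp_ne_zero)]
  simp [WithZero.exp]

end KInf

/-- The algebraic closure of `K_∞`. -/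
def KInfBar : Type _ := AlgebraicClosure (KInf F)

namespace KInfBar

instance : Field (KInfBar F) := inferInstanceAs (Field (AlgebraicClosure (KInf F)))
instance : Algebra (KInf F) (KInfBar F) :=
  inferInstanceAs (Algebra (KInf F) (AlgebraicClosure (KInf F)))
instance : IsAlgClosure (KInf F) (KInfBar F) :=
  inferInstanceAs (IsAlgClosure (KInf F) (AlgebraicClosure (KInf F)))
instance : Algebra.IsAlgebraic (KInf F) (KInfBar F) := IsAlgClosure.isAlgebraic

/-- The unique extension of the absolute value. -/
instance : NormedField (KInfBar F) := spectralNorm.normedField (KInf F) (KInfBar F)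

end KInfBar

/-- `ℂ_∞`: the completion of the algebraic closure of `K_∞`. -/
def CInf : Type _ := UniformSpace.Completion (KInfBar F)

namespace CInf

instance : NormedField (CInf F) :=
  inferInstanceAs (NormedField (UniformSpace.Completion (KInfBar F)))
instance : CompleteSpace (CInf F) :=
  inferInstanceAs (CompleteSpace (UniformSpace.Completion (KInfBar F)))

/-- The embedding `K_∞ → ℂ_∞`. -/
def ofKInf : KInf F →+* CInf F :=
  (UniformSpace.Completion.coeRingHom : KInfBar F →+* UniformSpace.Completion (KInfBar F)).comp
    (algebraMap (KInf F) (KInfBar F))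

instance : Algebra F (CInf F) := ((ofKInf F).comp (algebraMap F (KInf F))).toAlgebra

/-- The element `θ` of `ℂ_∞`. -/
def theta : CInf F := ofKInf F (KInf.theta F)

theorem norm_theta : ‖theta F‖ = Fintype.card F := by
  have h1 : ‖theta F‖ = ‖algebraMap (KInf F) (KInfBar F) (KInf.theta F)‖ :=
    UniformSpace.Completion.norm_coe _
  have h2 : ‖algebraMap (KInf F) (KInfBar F) (KInf.theta F)‖ = ‖KInf.theta F‖ :=
    spectralNorm_extends _
  rw [h1, h2, KInf.norm_theta]

/-- `A = 𝔽_q[θ]`, as a subring of `ℂ_∞`. -/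
def A : Subalgebra F (CInf F) := Algebra.adjoin F {theta F}

end CInf

end Fields

variable {F : Type*} [Field F] [Fintype F]

open CInf

/-! ### Power series in `t` over `ℂ_∞` -/

/-- Membership in the Tate algebra `𝕋`: the power series converges on `|t| ≤ 1`. -/
def InTate (f : (CInf F)⟦X⟧) : Prop := PowerSeries.IsRestricted 1 f

/-- Frobenius twisting `∑ a_i t^i ↦ ∑ a_i^q t^i`. -/
def twist (f : (CInf F)⟦X⟧) : (CInf F)⟦X⟧ :=
  PowerSeries.mk fun i => PowerSeries.coeff i f ^ Fintype.card F

/-- `f` converges at `t = θ` with value `v`. -/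
def HasValueAtTheta (f : (CInf F)⟦X⟧) (v : CInf F) : Prop :=
  HasSum (fun i : ℕ => PowerSeries.coeff i f * theta F ^ i) v

open scoped PowerSeries.WithPiTopology in
/-- `Ω = (-θ)^{-q/(q-1)} ∏_{i ≥ 1} (1 - t / θ^{q^i})`, where `ξ` is the fixed
`(q-1)`-th root of `-θ`. -/
def Omega (ξ : CInf F) : (CInf F)⟦X⟧ :=
  PowerSeries.C (ξ ^ Fintype.card F)⁻¹ *
    ∏' i : ℕ, (1 - PowerSeries.C (theta F ^ Fintype.card F ^ (i + 1))⁻¹ * PowerSeries.X)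

/-- `π̃ = 1 / Ω(θ)`. -/
def piTilde (ξ : CInf F) : CInf F :=
  (∑' i : ℕ, PowerSeries.coeff i (Omega ξ) * theta F ^ i)⁻¹

/-! ### The series -/

/-- `L_i = (θ - θ^q) ⋯ (θ - θ^{q^i})`, `L_0 = 1`. -/
def L (F : Type*) [Field F] [Fintype F] (i : ℕ) : CInf F :=
  ∏ j ∈ Finset.Icc 1 i, (theta F - theta F ^ Fintype.card F ^ j)

/-- The indices `0 ≤ i_1 < ⋯ < i_d`. -/
abbrev Idx (d : ℕ) : Type := {i : Fin d → ℕ // StrictMono i}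

/-- The general term of the Carlitz multiple polylogarithm. -/
def cmplTerm {d : ℕ} (n : Fin d → ℕ) (z : Fin d → CInf F) (i : Idx d) : CInf F :=
  ∏ k, z k ^ Fintype.card F ^ i.1 k / L F (i.1 k) ^ n k

/-- The Carlitz multiple polylogarithm `Li_{n_1,…,n_d}(z_1,…,z_d)`. -/
def cmpl {d : ℕ} (n : Fin d → ℕ) (z : Fin d → CInf F) : CInf F :=
  ∑' i : Idx d, cmplTerm n z i

/-- The region `𝔻`: `∏_k (|z_k| / |θ|^{q n_k/(q-1)})^{q^{i_k}} → 0`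
as `0 ≤ i_1 < ⋯ < i_d → ∞`. Here `d = m + 1`. -/
def regionD {m : ℕ} (n : Fin (m + 1) → ℕ) : Set (Fin (m + 1) → CInf F) :=
  {z | Tendsto
    (fun i : Idx (m + 1) => ∏ k,
      (‖z k‖ / ‖theta F‖ ^ ((Fintype.card F * n k : ℝ) / (Fintype.card F - 1 : ℝ))) ^
        Fintype.card F ^ i.1 k)
    (comap (fun i : Idx (m + 1) => i.1 (Fin.last m)) atTop) (𝓝 0)}

/-- The last `j + 1` entries of an `(m + 1)`-tuple. -/
def lastEntries {α : Type*} {m : ℕ} (j : Fin (m + 1)) (x : Fin (m + 1) → α) :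
    Fin (j + 1) → α :=
  fun l => x ⟨m - j + l, by omega⟩

/-- The vector
`(π̃^{n_1+⋯+n_{d-1}} Li_{n_d}(z_d), …, π̃^{n_1} Li_{n_2,…,n_d}(z_2,…,z_d), Li_{n_1,…,n_d}(z_1,…,z_d))`,
with `d = m + 1`. -/
def cmplVec (ξ : CInf F) {m : ℕ} (n : Fin (m + 1) → ℕ) (z : Fin (m + 1) → CInf F) :
    Fin (m + 1) → CInf F :=
  fun j => piTilde ξ ^ (∑ i : Fin (m + 1), if (i : ℕ) + j < m then n i else 0) *
    cmpl (lastEntries j n) (lastEntries j z)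

/-! ### The system of Artin-Schreier equations and the monodromy module -/

/-- `f = (1, f_1, …, f_k)` with `f_i ∈ 𝕋` solves
`f_i - f_i^{(1)} = Z_{k-i+1} · f_{i-1}^{(1)}` for `1 ≤ i ≤ k` (with `f_0 = 1`):
the components `f_i` are the branches of `𝔏i_{0,…,0}(Z_{k-i+1}, …, Z_k)`. -/
def IsSolution {k : ℕ} (Z : Fin k → (CInf F)⟦X⟧) (f : Fin (k + 1) → (CInf F)⟦X⟧) : Prop :=
  f 0 = 1 ∧ ∀ i : Fin k, InTate (f i.succ) ∧
    f i.succ - twist (f i.succ) = Z i.rev * twist (f i.castSucc)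

/-- The vector `(0, …, 0, 1, f_1, …, f_k)` of length `d = m + 1`. -/
def pad {m : ℕ} (k : Fin (m + 1)) (f : Fin (k + 1) → (CInf F)⟦X⟧) :
    Fin (m + 1) → (CInf F)⟦X⟧ :=
  fun j => if (j : ℕ) + k < m then 0 else f ⟨(j : ℕ) + k - m, by omega⟩

/-- `𝕄_{0,…,0}^{Z_1,…,Z_{d-1}}`, `d = m + 1`: the `𝔽_q[t]`-submodule generated by the vectors
`(0, …, 0, 1, f_1, …, f_k)`, `0 ≤ k ≤ d - 1`, where `f` solves the system for `Z_1, …, Z_k`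
(all branches are used, so that no choice is involved). -/
def tMonodromyZero {m : ℕ} (Z : Fin m → (CInf F)⟦X⟧) :
    Submodule F[X] (Fin (m + 1) → (CInf F)⟦X⟧) :=
  Submodule.span F[X]
    {g | ∃ (k : Fin (m + 1)) (f : Fin (k + 1) → (CInf F)⟦X⟧),
      IsSolution (fun l : Fin k => Z ⟨l, by omega⟩) f ∧ g = pad k f}

/-- `𝕄_{n_1,…,n_d}^{z_1,…,z_{d-1}} = Ω^{-n_1-⋯-n_d} 𝕄_{0,…,0}^{Ω^{n_1} z_1, …}`. -/
def tMonodromy (ξ : CInf F) {m : ℕ} (n : Fin (m + 1) → ℕ) (z : Fin m → CInf F) :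
    Submodule F[X] (Fin (m + 1) → (CInf F)⟦X⟧) :=
  (tMonodromyZero fun i => Omega ξ ^ n i.castSucc * PowerSeries.C (z i)).map
    (DistribSMul.toLinearMap F[X] (Fin (m + 1) → (CInf F)⟦X⟧) ((Omega ξ)⁻¹ ^ ∑ i, n i))

theorem X_smul_eq (f : (CInf F)⟦X⟧) : (X : F[X]) • f = PowerSeries.X * f := by
  rw [Algebra.smul_def, PowerSeries.algebraMap_apply']; simp

theorem C_smul_eq (a : F) (f : (CInf F)⟦X⟧) :
    (C a : F[X]) • f = PowerSeries.C (algebraMap F (CInf F) a) * f := by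
  rw [Algebra.smul_def, PowerSeries.algebraMap_apply']; simp

theorem HasValueAtTheta.smul {f : (CInf F)⟦X⟧} {v : CInf F} (h : HasValueAtTheta f v)
    (p : F[X]) : HasValueAtTheta (p • f) (aeval (theta F) p * v) := by
  induction p using Polynomial.induction_on' with
  | add p r hp hr =>
    have := HasSum.add hp hr
    rw [map_add, add_mul, add_smul]
    simpa only [HasValueAtTheta, map_add, add_mul] using this
  | monomial k a =>
    induction k with
    | zero =>
      have := h.mul_left (algebraMap F (CInf F) a)
      simpa only [HasValueAtTheta, monomial_zero_left, C_smul_eq, PowerSeries.coeff_C_mul,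
        aeval_C, mul_assoc] using this
    | succ k ih =>
      rw [← X_mul_monomial, mul_smul, X_smul_eq, map_mul, aeval_X]
      have h1 : HasSum (fun i : ℕ => PowerSeries.coeff (i + 1)
          (PowerSeries.X * ((monomial k a : F[X]) • f)) * theta F ^ (i + 1))
          (theta F * aeval (theta F) (monomial k a : F[X]) * v) := by
        have e : (fun i : ℕ => PowerSeries.coeff (i + 1)
            (PowerSeries.X * ((monomial k a : F[X]) • f)) * theta F ^ (i + 1)) =
            fun i : ℕ => theta F *
              (PowerSeries.coeff i ((monomial k a : F[X]) • f) * theta F ^ i) := by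
          funext i
          rw [PowerSeries.coeff_succ_X_mul]
          ring
        rw [e, mul_assoc]
        exact HasSum.mul_left (theta F) ih
      refine (hasSum_nat_add_iff' 1).mp ?_
      rw [Finset.sum_range_one, PowerSeries.coeff_zero_X_mul, zero_mul, sub_zero]
      exact h1

/-- The monodromy module `M_{n_1,…,n_d}^{z_1,…,z_{d-1}} ⊆ ℂ_∞^d`: the evaluation of
`𝕄_{n_1,…,n_d}^{z_1,…,z_{d-1}}` at `t = θ`. -/
def monodromy (ξ : CInf F) {m : ℕ} (n : Fin (m + 1) → ℕ) (z : Fin m → CInf F) :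
    Submodule (A F) (Fin (m + 1) → CInf F) where
  carrier := {v | ∃ g ∈ tMonodromy ξ n z, ∀ j, HasValueAtTheta (g j) (v j)}
  zero_mem' := ⟨0, Submodule.zero_mem _, fun j => by simp [HasValueAtTheta]⟩
  add_mem' := by
    rintro v w ⟨g, hg, hv⟩ ⟨h, hh, hw⟩
    refine ⟨g + h, Submodule.add_mem _ hg hh, fun j => ?_⟩
    have := (hv j).add (hw j)
    simpa [HasValueAtTheta, add_mul] using this
  smul_mem' := by
    rintro ⟨a, ha⟩ v ⟨g, hg, hv⟩
    rw [A, Algebra.adjoin_singleton_eq_range_aeval] at ha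
    obtain ⟨p, rfl⟩ := ha
    exact ⟨p • g, Submodule.smul_mem _ _ hg, fun j => (hv j).smul p⟩

/-! ### The continued Carlitz multiple polylogarithm -/

/-- `v ∈ ℂ_∞^d` is a branch of the continued Carlitz multiple polylogarithm at `z = (z_1,…,z_d)`:
the value at `t = θ` of `Ω^{-n_1-⋯-n_d} · (f_1, …, f_d)`, where `(f_1, …, f_d) ∈ 𝕋^d` solves the
system for `Ω^{n_1} z_1, …, Ω^{n_d} z_d`. -/
def IsBranchValue (ξ : CInf F) {m : ℕ} (n : Fin (m + 1) → ℕ) (z : Fin (m + 1) → CInf F)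
    (v : Fin (m + 1) → CInf F) : Prop :=
  ∃ f : Fin (m + 2) → (CInf F)⟦X⟧,
    IsSolution (fun i => Omega ξ ^ n i * PowerSeries.C (z i)) f ∧
    ∀ j : Fin (m + 1), HasValueAtTheta ((Omega ξ)⁻¹ ^ (∑ i, n i) * f j.succ) (v j)

/-- The continued Carlitz multiple polylogarithm
`Li⃗_{n_1,…,n_d}(z_1,…,z_{d-1},-) : ℂ_∞ → ℂ_∞^d / M_{n_1,…,n_d}^{z_1,…,z_{d-1}}`,
the common class of all branch values. -/
def contCMPL (ξ : CInf F) {m : ℕ} (n : Fin (m + 1) → ℕ) (z : Fin m → CInf F) (w : CInf F) :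
    (Fin (m + 1) → CInf F) ⧸ monodromy ξ n z :=
  Submodule.Quotient.mk
    (Classical.epsilon (IsBranchValue ξ n (Fin.snoc z w : Fin (m + 1) → CInf F)))

/-- `φ` is a rigid analytic function on the closed disk of centre `c` and radius `r`:
it is given there by a power series `∑ a_k (x - c)^k` with `|a_k| r^k → 0`. -/
def IsRigidAnalyticOnDisk (φ : CInf F → CInf F) (c : CInf F) (r : ℝ) : Prop :=
  ∃ a : ℕ → CInf F, Tendsto (fun k => ‖a k‖ * r ^ k) atTop (𝓝 0) ∧
    ∀ x ∈ Metric.closedBall c r, HasSum (fun k => a k * (x - c) ^ k) (φ x)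

/-- A map `g : ℂ_∞ → ℂ_∞^d / M` is locally rigid-analytic: around every point `x₀` there are a
closed disk `U` and a closed polydisk `V ⊆ ℂ_∞^d` (of radii in `|ℂ_∞^×|`) such that `V` injects
into the quotient, the image of `V` contains `g(U)`, and the induced map `U → V` is rigid
analytic in every coordinate. -/
def IsLocallyRigidAnalytic {d : ℕ} (M : Submodule (A F) (Fin d → CInf F))
    (g : CInf F → (Fin d → CInf F) ⧸ M) : Prop :=
  ∀ x₀ : CInf F, ∃ (ρ σ : CInf F) (c : Fin d → CInf F), ρ ≠ 0 ∧ σ ≠ 0 ∧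
    Set.InjOn (Submodule.Quotient.mk (p := M)) (Metric.closedBall c ‖σ‖) ∧
    ∃ φ : CInf F → Fin d → CInf F,
      (∀ x ∈ Metric.closedBall x₀ ‖ρ‖,
        φ x ∈ Metric.closedBall c ‖σ‖ ∧ Submodule.Quotient.mk (p := M) (φ x) = g x) ∧
      ∀ j, IsRigidAnalyticOnDisk (fun x => φ x j) x₀ ‖ρ‖

end CarlitzMPL

end

open Filter Topology Polynomial
open scoped PowerSeries NNReal WithZero

noncomputable section

namespace CarlitzMPL

variable {F : Type*} [Field F] [Fintype F]

open CInf

/-! ### The field `ℂ_∞` -/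

/-! Removing the factor `Ω^{-N}` leaves a triangular system of Artin–Schreier equations over the
Tate algebra. With `z_1, …, z_{d-1}` fixed, the last variable `w = z_d` occurs only in the
right-hand side `Ω^{n_d} w` of the first equation, so the solutions depend additively on `w`, and
those for `w = 0` form an `𝔽_q[t]`-module.

Existence: `f - f^{(1)} = b` is solved coefficient by coefficient, and a coefficient `b_i` with
`|b_i| < 1` has a solution no larger than `b_i` (`exists_sub_twist_eq`). Convergence at `θ`: almost
all coefficients `a` of a Tate series satisfy `|a| < 1`, whence `|a - a^q| = |a|`; so `f` decays as
fast as `f - f^{(1)}` (`isRestricted_of_sub_twist`), and this passes up the system because `Ω` and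
`Ω^{-1}` converge beyond `|t| = |θ|`.

Monodromy: Tate series fixed by the twist are polynomials over `𝔽_q`. The first nonzero component of
a homogeneous solution is therefore such a polynomial `p`. Subtracting `p` times a padded solution
shows that the given generators span all homogeneous solutions (`tMonodromyZero_eq`); hence `M` is
the set of branch values at `w = 0`, and additivity gives the coset statement and linearity. Since
`|p(θ)| ≥ 1` for `p ≠ 0`, a homogeneous solution with all values smaller than `1` vanishes, which is
discreteness.

Comparison: the sums of `∏ Z_k^{(i_k)}` over increasing tuples solve the system, as seen by
separating `i_1 = 0` from `i_1 > 0` (`sub_twist_eq_of_hasSum`). The functional equation of `Ω` gives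
`Ω^{(i)}(θ) = π̃^{-1}/L_i`, which turns these sums into polylogarithms at `t = θ`. One weight
controls both the terms of the polylogarithm and the Gauss norms of the deformed terms, so `𝔻` is
exactly the domain of convergence, and summation may be exchanged with evaluation.

Local analyticity: for any `z_1, …, z_{d-1}` all the series converge when `w` is near `0`, to small
values analytic in `w`. Additivity moves this to every `x₀`, and discreteness supplies a polydisk
that injects into the quotient. -/

instance CInf.isUltrametricDist : IsUltrametricDist (CInf F) := by
  refine IsUltrametricDist.isUltrametricDist_of_isNonarchimedean_norm
    (S' := UniformSpace.Completion (KInfBar F)) fun x y => ?_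
  refine UniformSpace.Completion.induction_on₂ x y
    (isClosed_le (by fun_prop) (by fun_prop)) fun a b => ?_
  rw [← UniformSpace.Completion.coe_add]
  simp only [UniformSpace.Completion.norm_coe]
  exact isNonarchimedean_spectralNorm (K := KInf F) (L := KInfBar F) a b

theorem one_lt_norm_theta : 1 < ‖theta F‖ := by
  rw [CInf.norm_theta]
  exact_mod_cast Fintype.one_lt_card (α := F)

theorem theta_ne_zero : theta F ≠ 0 := norm_pos_iff.mp (one_pos.trans one_lt_norm_theta)

variable (F) in
/-- The `q`-power Frobenius of `ℂ_∞`. -/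
def frob : CInf F →+* CInf F := (FiniteField.frobeniusAlgHom F (CInf F)).toRingHom

theorem frob_apply (a : CInf F) : frob F a = a ^ Fintype.card F := rfl

theorem frob_algebraMap (c : F) : frob F (algebraMap F (CInf F) c) = algebraMap F (CInf F) c :=
  (FiniteField.frobeniusAlgHom F (CInf F)).commutes c

theorem continuous_frob : Continuous (frob F) := by
  change Continuous fun a : CInf F => a ^ Fintype.card F
  fun_prop

theorem norm_algebraMap {c : F} (hc : c ≠ 0) : ‖algebraMap F (CInf F) c‖ = 1 := by
  have h : algebraMap F (CInf F) c ^ (Fintype.card F - 1) = 1 := by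
    rw [← map_pow, FiniteField.pow_card_sub_one_eq_one c hc, map_one]
  have h' := congrArg norm h
  rw [norm_pow, norm_one] at h'
  exact (pow_eq_one_iff_of_nonneg (norm_nonneg _)
    (Nat.sub_ne_zero_of_lt Fintype.one_lt_card)).mp h'

theorem norm_algebraMap_le (c : F) : ‖algebraMap F (CInf F) c‖ ≤ 1 := by
  rcases eq_or_ne c 0 with rfl | hc
  · simp
  · exact (norm_algebraMap hc).le

/-- The fixed points of Frobenius are the constants. -/
theorem exists_algebraMap_eq {a : CInf F} (h : frob F a = a) : ∃ c : F, algebraMap F _ c = a := by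
  have hne : (X ^ Fintype.card F - X : F[X]).map (algebraMap F (CInf F)) ≠ 0 :=
    (Polynomial.map_ne_zero_iff (algebraMap F (CInf F)).injective).mpr
      (FiniteField.X_pow_card_sub_X_ne_zero F Fintype.one_lt_card)
  have hs : (X ^ Fintype.card F - X : F[X]).Splits := by
    rw [splits_iff_card_roots, FiniteField.roots_X_pow_card_sub_X,
      FiniteField.X_pow_card_sub_X_natDegree_eq F Fintype.one_lt_card]
    rfl
  have hr : a ∈ ((X ^ Fintype.card F - X : F[X]).map (algebraMap F (CInf F))).roots := by
    rw [mem_roots hne]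
    simp [IsRoot, ← frob_apply, h]
  rw [hs.roots_map, Multiset.mem_map] at hr
  obtain ⟨c, -, hc⟩ := hr
  exact ⟨c, hc⟩

/-- Horner's scheme: in `p = X · p.divX + p(0)` the first summand has norm greater than `1` at `θ`
unless `p` is constant, and a constant has norm at most `1`, so it cannot cancel. This is the source
of discreteness. -/
theorem one_le_norm_aeval_theta {p : F[X]} (hp : p ≠ 0) : 1 ≤ ‖aeval (theta F) p‖ := by
  induction h : p.natDegree using Nat.strong_induction_on generalizing p with
  | _ k ih =>
    rcases eq_or_ne p.divX 0 with h0 | h0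
    · rw [divX_eq_zero_iff] at h0
      have hc : p.coeff 0 ≠ 0 := fun hc => hp (by rw [h0, hc, C_0])
      rw [h0, aeval_C, norm_algebraMap hc]
    · have hk : p.natDegree ≠ 0 := fun hk =>
        h0 (divX_eq_zero_iff.mpr (eq_C_of_natDegree_eq_zero hk))
      have h1 := ih p.divX.natDegree (by rw [natDegree_divX_eq_natDegree_tsub_one]; omega) h0 rfl
      have h2 : 1 < ‖aeval (theta F) p.divX * theta F‖ := by
        rw [norm_mul]
        exact one_lt_mul_of_le_of_lt h1 one_lt_norm_theta
      have h3 := norm_algebraMap_le (p.coeff 0)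
      have e : aeval (theta F) p = aeval (theta F) p.divX * theta F
          + algebraMap F (CInf F) (p.coeff 0) := by
        conv_lhs => rw [← divX_mul_X_add p]
        simp
      rw [e, IsUltrametricDist.norm_add_eq_max_of_norm_ne_norm (h3.trans_lt h2).ne']
      exact le_max_of_le_left h2.le

/-! ### Artin–Schreier equations in `ℂ_∞` -/

theorem norm_sub_frob {a : CInf F} (ha : ‖a‖ < 1) : ‖a - frob F a‖ = ‖a‖ := by
  rcases eq_or_ne a 0 with rfl | h0
  · simp
  have h : ‖-frob F a‖ < ‖a‖ := by
    rw [norm_neg, frob_apply, norm_pow]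
    exact pow_lt_self_of_lt_one₀ (norm_pos_iff.mpr h0) ha Fintype.one_lt_card
  rw [sub_eq_add_neg, IsUltrametricDist.norm_add_eq_max_of_norm_ne_norm h.ne', max_eq_left h.le]

/-- The series `∑ b^{q^i}` telescopes. The bound on `a` is what later keeps coefficientwise
solutions inside the Tate algebra. -/
theorem exists_sub_frob_eq_of_norm_lt_one {b : CInf F} (hb : ‖b‖ < 1) :
    ∃ a, a - frob F a = b ∧ ‖a‖ ≤ ‖b‖ := by
  have hle : ∀ i, ‖b ^ Fintype.card F ^ i‖ ≤ ‖b‖ ^ i := fun i => by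
    rw [norm_pow]
    exact pow_le_pow_of_le_one (norm_nonneg _) hb.le (Nat.lt_pow_self Fintype.one_lt_card).le
  have hs : Summable fun i : ℕ => b ^ Fintype.card F ^ i := by
    refine NonarchimedeanAddGroup.summable_of_tendsto_cofinite_zero ?_
    rw [Nat.cofinite_eq_atTop]
    exact squeeze_zero_norm hle (tendsto_pow_atTop_nhds_zero_of_lt_one (norm_nonneg _) hb)
  refine ⟨∑' i : ℕ, b ^ Fintype.card F ^ i, ?_, ?_⟩
  · rw [hs.map_tsum (frob F) continuous_frob, hs.tsum_eq_zero_add]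
    simp [frob_apply, ← pow_mul, pow_succ]
  · refine IsUltrametricDist.norm_tsum_le_of_forall_le fun i => ?_
    rw [norm_pow]
    exact pow_le_of_le_one (norm_nonneg _) hb.le (pow_pos Fintype.card_pos _).ne'

variable (F) in
/-- The embedding of the algebraic closure of `K_∞` into `ℂ_∞`. -/
def ofKInfBar : KInfBar F →+* CInf F :=
  (UniformSpace.Completion.coeRingHom : KInfBar F →+* UniformSpace.Completion (KInfBar F))

theorem exists_norm_sub_ofKInfBar_lt_one (b : CInf F) : ∃ y, ‖b - ofKInfBar F y‖ < 1 := by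
  have h : DenseRange (ofKInfBar F) := UniformSpace.Completion.denseRange_coe
  obtain ⟨y, hy⟩ := h.exists_dist_lt b one_pos
  exact ⟨y, by rwa [← dist_eq_norm]⟩

/-- The equation is additive, so `b` may be split into an element algebraic over `K_∞` and a
remainder of norm less than `1`; the first is handled in the algebraic closure, the second by the
telescoping series. -/
theorem exists_sub_frob_eq (b : CInf F) : ∃ a, a - frob F a = b := by
  obtain ⟨y, hy⟩ := exists_norm_sub_ofKInfBar_lt_one b
  have hac : IsAlgClosed (KInfBar F) := IsAlgClosure.isAlgClosed (KInf F)
  have hd : (X ^ Fintype.card F - X + Polynomial.C y : (KInfBar F)[X]).degree ≠ 0 := by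
    have h1 : (X ^ Fintype.card F - X : (KInfBar F)[X]).natDegree = Fintype.card F :=
      FiniteField.X_pow_card_sub_X_natDegree_eq _ Fintype.one_lt_card
    have h2 : (X ^ Fintype.card F - X + Polynomial.C y : (KInfBar F)[X]).natDegree
        = Fintype.card F := by rw [natDegree_add_C, h1]
    intro h
    rw [natDegree_eq_of_degree_eq_some h] at h2
    exact Fintype.card_ne_zero h2.symm
  obtain ⟨x, hx⟩ := IsAlgClosed.exists_root _ hd
  simp only [IsRoot, eval_add, eval_sub, eval_pow, eval_X, eval_C] at hx
  have hx' : x - x ^ Fintype.card F = y := by linear_combination -hx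
  obtain ⟨a, ha, -⟩ := exists_sub_frob_eq_of_norm_lt_one hy
  refine ⟨a + ofKInfBar F x, ?_⟩
  rw [map_add, add_sub_add_comm, ha, frob_apply, ← map_pow, ← map_sub, hx', sub_add_cancel]

/-! ### Twisting, convergence and evaluation of power series -/

theorem twist_eq_map (f : (CInf F)⟦X⟧) : twist f = PowerSeries.map (frob F) f := by
  ext i
  rw [twist, PowerSeries.coeff_mk, PowerSeries.coeff_map, frob_apply]

theorem coeff_twist (f : (CInf F)⟦X⟧) (i : ℕ) :
    PowerSeries.coeff i (twist f) = PowerSeries.coeff i f ^ Fintype.card F :=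
  PowerSeries.coeff_mk _ _

theorem coeff_twist_iterate (f : (CInf F)⟦X⟧) (k i : ℕ) :
    PowerSeries.coeff i (twist^[k] f) = PowerSeries.coeff i f ^ Fintype.card F ^ k := by
  induction k with
  | zero => simp
  | succ k ih => rw [Function.iterate_succ_apply', coeff_twist, ih, ← pow_mul, pow_succ]

theorem twist_iterate_mul (f g : (CInf F)⟦X⟧) (k : ℕ) :
    twist^[k] (f * g) = twist^[k] f * twist^[k] g :=
  Function.Semiconj₂.iterate (fun f g => by simp only [twist_eq_map, map_mul]) k f g

theorem twist_iterate_pow (f : (CInf F)⟦X⟧) (k n : ℕ) :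
    twist^[k] (f ^ n) = twist^[k] f ^ n := by
  induction n with
  | zero =>
    have h : twist (1 : (CInf F)⟦X⟧) = 1 := by rw [twist_eq_map, map_one]
    simpa using Function.iterate_fixed h k
  | succ n ih => rw [pow_succ, twist_iterate_mul, ih, pow_succ]

theorem twist_iterate_C (a : CInf F) (k : ℕ) :
    twist^[k] (PowerSeries.C a) = PowerSeries.C (a ^ Fintype.card F ^ k) := by
  ext i
  rw [coeff_twist_iterate, PowerSeries.coeff_C, PowerSeries.coeff_C]
  split_ifs with h
  · rfl
  · exact zero_pow (pow_pos Fintype.card_pos _).ne'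

theorem twist_smul (p : F[X]) (f : (CInf F)⟦X⟧) : twist (p • f) = p • twist f := by
  induction p using Polynomial.induction_on' with
  | add p r hp hr =>
    simp only [add_smul, twist_eq_map, map_add] at hp hr ⊢
    rw [hp, hr]
  | monomial k a =>
    induction k with
    | zero =>
      rw [monomial_zero_left, C_smul_eq, C_smul_eq, twist_eq_map, twist_eq_map, map_mul,
        PowerSeries.map_C, frob_algebraMap]
    | succ k ih =>
      rw [← X_mul_monomial, mul_smul, mul_smul, X_smul_eq, X_smul_eq, ← ih, twist_eq_map,
        twist_eq_map, map_mul, PowerSeries.map_X]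

open scoped PowerSeries.WithPiTopology in
theorem continuous_twist : Continuous (PowerSeries.map (frob F)) := by
  refine continuous_iff_continuousAt.mpr fun f => ?_
  refine (PowerSeries.WithPiTopology.tendsto_iff_coeff_tendsto _ _ _ _).mpr fun d => ?_
  simp only [PowerSeries.coeff_map]
  exact (continuous_frob.comp
    (PowerSeries.WithPiTopology.continuous_coeff (CInf F) d)).continuousAt

section Restricted

variable {r : ℝ}

theorem isRestricted_mono {s : ℝ} (hs : 0 ≤ s) (h : s ≤ r) {f : (CInf F)⟦X⟧}
    (hf : PowerSeries.IsRestricted r f) : PowerSeries.IsRestricted s f := by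
  rw [PowerSeries.isRestricted_iff'] at hf ⊢
  exact squeeze_zero (fun n => by positivity) (fun n => by gcongr) hf

theorem tendsto_norm_coeff (hr : 1 ≤ r) {f : (CInf F)⟦X⟧} (hf : PowerSeries.IsRestricted r f) :
    Tendsto (fun i => ‖PowerSeries.coeff i f‖) atTop (𝓝 0) := by
  have h := (PowerSeries.isRestricted_iff' 1 f).mp (isRestricted_mono zero_le_one hr hf)
  simpa using h

theorem isRestricted_twist (hr : 1 ≤ r) {f : (CInf F)⟦X⟧} (hf : PowerSeries.IsRestricted r f) :
    PowerSeries.IsRestricted r (twist f) := by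
  have h1 := (tendsto_norm_coeff hr hf).eventually (gt_mem_nhds one_pos)
  rw [PowerSeries.isRestricted_iff'] at hf ⊢
  refine squeeze_zero' (.of_forall fun n => by positivity) (h1.mono fun n hn => ?_) hf
  rw [coeff_twist, norm_pow]
  gcongr
  exact pow_le_of_le_one (norm_nonneg _) hn.le Fintype.card_ne_zero

/-- Membership in the Tate algebra makes almost all coefficients smaller than `1`, where `a` and `a
- a^q` have equal norm. Decay at any radius thus passes from `f - f^{(1)}` to `f`. -/
theorem isRestricted_of_sub_twist {f : (CInf F)⟦X⟧} (hf : InTate f)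
    (h : PowerSeries.IsRestricted r (f - twist f)) : PowerSeries.IsRestricted r f := by
  have h1 := (tendsto_norm_coeff le_rfl hf).eventually (gt_mem_nhds one_pos)
  rw [PowerSeries.isRestricted_iff'] at h ⊢
  refine h.congr' (h1.mono fun n hn => ?_)
  rw [map_sub, coeff_twist, ← frob_apply, norm_sub_frob hn]

theorem isRestricted_pow {f : (CInf F)⟦X⟧} (hf : PowerSeries.IsRestricted r f) (n : ℕ) :
    PowerSeries.IsRestricted r (f ^ n) :=
  (PowerSeries.IsRestricted.subring r).pow_mem hf n

theorem isRestricted_smul {f : (CInf F)⟦X⟧} (hf : PowerSeries.IsRestricted r f) (p : F[X]) :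
    PowerSeries.IsRestricted r (p • f) := by
  have hX : PowerSeries.IsRestricted r (PowerSeries.X : (CInf F)⟦X⟧) :=
    PowerSeries.isRestricted_monomial r 1 1
  induction p using Polynomial.induction_on' with
  | add p s hp hs =>
    rw [add_smul]
    exact PowerSeries.isRestricted.add r hp hs
  | monomial k a =>
    induction k with
    | zero =>
      rw [monomial_zero_left, C_smul_eq]
      exact PowerSeries.isRestricted.mul r (PowerSeries.isRestricted_C r _) hf
    | succ k ih =>
      rw [← X_mul_monomial, mul_smul, X_smul_eq]
      exact PowerSeries.isRestricted.mul r hX ih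

theorem exists_sub_twist_eq {b : (CInf F)⟦X⟧} (hb : InTate b) :
    ∃ a, InTate a ∧ a - twist a = b := by
  have h : ∀ i, ∃ a, a - frob F a = PowerSeries.coeff i b ∧
      (‖PowerSeries.coeff i b‖ < 1 → ‖a‖ ≤ ‖PowerSeries.coeff i b‖) := fun i => by
    by_cases hi : ‖PowerSeries.coeff i b‖ < 1
    · obtain ⟨a, h1, h2⟩ := exists_sub_frob_eq_of_norm_lt_one hi
      exact ⟨a, h1, fun _ => h2⟩
    · obtain ⟨a, h1⟩ := exists_sub_frob_eq (PowerSeries.coeff i b)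
      exact ⟨a, h1, fun h => absurd h hi⟩
  choose a h1 h2 using h
  refine ⟨PowerSeries.mk a, ?_, ?_⟩
  · have h3 := tendsto_norm_coeff le_rfl hb
    refine (PowerSeries.isRestricted_iff' _ _).mpr ?_
    refine squeeze_zero' (.of_forall fun n => by positivity)
      ((h3.eventually (gt_mem_nhds one_pos)).mono fun n hn => ?_) h3
    simpa using h2 n hn
  · ext i
    rw [map_sub, coeff_twist, PowerSeries.coeff_mk, ← frob_apply, h1]

end Restricted

section Evaluation

theorem isRestricted_theta_iff_summable {f : (CInf F)⟦X⟧} :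
    PowerSeries.IsRestricted ‖theta F‖ f ↔
      Summable fun i : ℕ => PowerSeries.coeff i f * theta F ^ i := by
  rw [NonarchimedeanAddGroup.summable_iff_tendsto_cofinite_zero, PowerSeries.isRestricted_iff,
    tendsto_zero_iff_norm_tendsto_zero (f := fun i => PowerSeries.coeff i f * theta F ^ i)]
  simp only [norm_mul, norm_pow]

theorem HasValueAtTheta.isRestricted {f : (CInf F)⟦X⟧} {v : CInf F} (h : HasValueAtTheta f v) :
    PowerSeries.IsRestricted ‖theta F‖ f :=
  isRestricted_theta_iff_summable.mpr h.summable

theorem exists_hasValueAtTheta {f : (CInf F)⟦X⟧} (h : PowerSeries.IsRestricted ‖theta F‖ f) :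
    ∃ v, HasValueAtTheta f v :=
  ⟨_, (isRestricted_theta_iff_summable.mp h).hasSum⟩

theorem inTate_of_isRestricted {f : (CInf F)⟦X⟧} (h : PowerSeries.IsRestricted ‖theta F‖ f) :
    InTate f :=
  isRestricted_mono zero_le_one one_lt_norm_theta.le h

theorem HasValueAtTheta.add {f g : (CInf F)⟦X⟧} {v w : CInf F} (hf : HasValueAtTheta f v)
    (hg : HasValueAtTheta g w) : HasValueAtTheta (f + g) (v + w) := by
  have := HasSum.add hf hg
  simpa only [HasValueAtTheta, map_add, add_mul] using this

theorem HasValueAtTheta.sub {f g : (CInf F)⟦X⟧} {v w : CInf F} (hf : HasValueAtTheta f v)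
    (hg : HasValueAtTheta g w) : HasValueAtTheta (f - g) (v - w) := by
  have := HasSum.sub hf hg
  simpa only [HasValueAtTheta, map_sub, sub_mul] using this

theorem hasSum_sum_antidiagonal_of_isUltrametricDist {K : Type*} [NormedField K]
    [IsUltrametricDist K] [CompleteSpace K] {f g : ℕ → K} {a b : K} (hf : HasSum f a)
    (hg : HasSum g b) :
    HasSum (fun n => ∑ kl ∈ Finset.HasAntidiagonal.antidiagonal n, f kl.1 * g kl.2) (a * b) := by
  have : NonarchimedeanRing K := ⟨NonarchimedeanAddGroup.is_nonarchimedean⟩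
  have h := (hf.mul_of_nonarchimedean hg).summable
  have h3 := (summable_sum_mul_antidiagonal_of_summable_mul h).hasSum
  rwa [← hf.summable.tsum_mul_tsum_eq_tsum_sum_antidiagonal hg.summable h,
    hf.tsum_eq, hg.tsum_eq] at h3

theorem HasValueAtTheta.mul {f g : (CInf F)⟦X⟧} {v w : CInf F} (hf : HasValueAtTheta f v)
    (hg : HasValueAtTheta g w) : HasValueAtTheta (f * g) (v * w) := by
  refine (hasSum_sum_antidiagonal_of_isUltrametricDist hf hg).congr_fun ?_
  intro n
  rw [PowerSeries.coeff_mul, Finset.sum_mul]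
  refine Finset.sum_congr rfl fun kl hkl => ?_
  rw [← Finset.HasAntidiagonal.mem_antidiagonal.mp hkl, pow_add]
  ring

theorem hasValueAtTheta_C (a : CInf F) : HasValueAtTheta (PowerSeries.C a) a := by
  have := hasSum_single (f := fun i : ℕ => PowerSeries.coeff i (PowerSeries.C a) * theta F ^ i) 0
    fun i hi => by simp [PowerSeries.coeff_C, hi]
  simpa [HasValueAtTheta] using this

theorem hasValueAtTheta_X : HasValueAtTheta (PowerSeries.X : (CInf F)⟦X⟧) (theta F) := by
  have := hasSum_single
    (f := fun i : ℕ => PowerSeries.coeff i (PowerSeries.X : (CInf F)⟦X⟧) * theta F ^ i) 1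
    fun i hi => by simp [PowerSeries.coeff_X, hi]
  simpa [HasValueAtTheta] using this

theorem hasValueAtTheta_one : HasValueAtTheta (1 : (CInf F)⟦X⟧) 1 := by
  simpa using hasValueAtTheta_C (1 : CInf F)

theorem HasValueAtTheta.pow {f : (CInf F)⟦X⟧} {v : CInf F} (h : HasValueAtTheta f v) (n : ℕ) :
    HasValueAtTheta (f ^ n) (v ^ n) := by
  induction n with
  | zero => simpa using hasValueAtTheta_one
  | succ n ih => simpa only [pow_succ] using ih.mul h

theorem HasValueAtTheta.prod {ι : Type*} {s : Finset ι} {f : ι → (CInf F)⟦X⟧} {v : ι → CInf F}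
    (h : ∀ i ∈ s, HasValueAtTheta (f i) (v i)) :
    HasValueAtTheta (∏ i ∈ s, f i) (∏ i ∈ s, v i) := by
  classical
  induction s using Finset.induction_on with
  | empty => simpa using hasValueAtTheta_one
  | insert a s ha ih =>
    rw [Finset.prod_insert ha, Finset.prod_insert ha]
    exact (h a (Finset.mem_insert_self _ _)).mul
      (ih fun i hi => h i (Finset.mem_insert_of_mem hi))

theorem HasValueAtTheta.unique {f : (CInf F)⟦X⟧} {v w : CInf F} (hv : HasValueAtTheta f v)
    (hw : HasValueAtTheta f w) : v = w :=
  HasSum.unique hv hw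

end Evaluation

/-! ### Bounds for the Gauss norm of radius `r` -/

/-- The Gauss norm of radius `r` of `f` is at most `c`. -/
def GaussLE (r c : ℝ) (f : (CInf F)⟦X⟧) : Prop :=
  ∀ i, ‖PowerSeries.coeff i f‖ * r ^ i ≤ c

namespace GaussLE

variable {r : ℝ}

theorem nonneg {c : ℝ} {f : (CInf F)⟦X⟧} (hf : GaussLE r c f) : 0 ≤ c := by
  have := hf 0
  rw [pow_zero, mul_one] at this
  exact (norm_nonneg _).trans this

theorem C (a : CInf F) : GaussLE r ‖a‖ (PowerSeries.C a) := fun i => by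
  rw [PowerSeries.coeff_C]
  split_ifs with h
  · simp [h]
  · simp

theorem one : GaussLE r 1 (1 : (CInf F)⟦X⟧) := by
  simpa using C (1 : CInf F) (r := r)

theorem mul (hr : 0 ≤ r) {c c' : ℝ} {f g : (CInf F)⟦X⟧} (hf : GaussLE r c f)
    (hg : GaussLE r c' g) : GaussLE r (c * c') (f * g) := fun n => by
  rcases hr.eq_or_lt with rfl | hr
  · rcases n with _ | n
    · have h1 := hf 0
      have h2 := hg 0
      simp only [pow_zero, mul_one, PowerSeries.coeff_zero_eq_constantCoeff, map_mul,
        norm_mul] at h1 h2 ⊢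
      exact mul_le_mul h1 h2 (norm_nonneg _) hf.nonneg
    · simpa using mul_nonneg hf.nonneg hg.nonneg
  rw [PowerSeries.coeff_mul, ← le_div_iff₀ (by positivity)]
  refine IsUltrametricDist.norm_sum_le_of_forall_le_of_nonneg
    (div_nonneg (mul_nonneg hf.nonneg hg.nonneg) (by positivity)) fun kl hkl => ?_
  rw [le_div_iff₀ (by positivity), ← Finset.HasAntidiagonal.mem_antidiagonal.mp hkl, pow_add, norm_mul]
  calc _ = (‖PowerSeries.coeff kl.1 f‖ * r ^ kl.1) * (‖PowerSeries.coeff kl.2 g‖ * r ^ kl.2) := by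
        ring
    _ ≤ _ := mul_le_mul (hf _) (hg _) (by positivity) hf.nonneg

theorem pow (hr : 0 ≤ r) {c : ℝ} {f : (CInf F)⟦X⟧} (hf : GaussLE r c f) (n : ℕ) :
    GaussLE r (c ^ n) (f ^ n) := by
  induction n with
  | zero => simpa using one
  | succ n ih => simpa only [pow_succ] using ih.mul hr hf

theorem prod (hr : 0 ≤ r) {ι : Type*} {s : Finset ι} {c : ι → ℝ} {f : ι → (CInf F)⟦X⟧}
    (h : ∀ i ∈ s, GaussLE r (c i) (f i)) : GaussLE r (∏ i ∈ s, c i) (∏ i ∈ s, f i) := by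
  classical
  induction s using Finset.induction_on with
  | empty => simpa using one
  | insert a s ha ih =>
    rw [Finset.prod_insert ha, Finset.prod_insert ha]
    exact (h a (Finset.mem_insert_self _ _)).mul hr
      (ih fun i hi => h i (Finset.mem_insert_of_mem hi))

/-- Twisting raises the coefficients to the power `q^k` but leaves `t` alone; `r ≥ 1` allows `r^i`
to be replaced by its `q^k`-th power. -/
theorem twist_iterate (hr : 1 ≤ r) {c : ℝ} {f : (CInf F)⟦X⟧} (hf : GaussLE r c f) (k : ℕ) :
    GaussLE r (c ^ Fintype.card F ^ k) (twist^[k] f) := fun i => by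
  rw [coeff_twist_iterate, norm_pow]
  calc _ ≤ ‖PowerSeries.coeff i f‖ ^ Fintype.card F ^ k * (r ^ i) ^ Fintype.card F ^ k := by
        gcongr
        exact le_self_pow₀ (one_le_pow₀ hr) (pow_pos Fintype.card_pos _).ne'
    _ = (‖PowerSeries.coeff i f‖ * r ^ i) ^ Fintype.card F ^ k := (mul_pow _ _ _).symm
    _ ≤ _ := by
        have h0 : 0 ≤ ‖PowerSeries.coeff i f‖ * r ^ i := by positivity
        exact pow_le_pow_left₀ h0 (hf i) _

/-- Induction along the recursion for the coefficients of the inverse, which involves only products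
of bounded terms. It yields convergence of `Ω^{-1}` at `θ`. -/
theorem inv (hr : 0 < r) {f : (CInf F)⟦X⟧} (hf : GaussLE r 1 f)
    (h : PowerSeries.constantCoeff f = 1) : GaussLE r 1 f⁻¹ := fun n => by
  induction n using Nat.strong_induction_on with
  | _ n ih =>
    rw [PowerSeries.coeff_inv]
    split_ifs with hn
    · simp [hn, h]
    rw [← le_div_iff₀ (by positivity), h, inv_one, neg_one_mul, norm_neg]
    refine IsUltrametricDist.norm_sum_le_of_forall_le_of_nonneg (by positivity) fun kl hkl => ?_
    split_ifs with hlt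
    · rw [le_div_iff₀ (by positivity), ← Finset.HasAntidiagonal.mem_antidiagonal.mp hkl, pow_add, norm_mul]
      calc _ = (‖PowerSeries.coeff kl.1 f‖ * r ^ kl.1) *
            (‖PowerSeries.coeff kl.2 f⁻¹‖ * r ^ kl.2) := by ring
        _ ≤ 1 := mul_le_one₀ (hf _) (by positivity) (ih _ hlt)
    · simp only [norm_zero]
      positivity

theorem mono (hr : 0 ≤ r) {s c : ℝ} (h : r ≤ s) {f : (CInf F)⟦X⟧} (hf : GaussLE s c f) :
    GaussLE r c f := fun i => le_trans (by gcongr) (hf i)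

theorem isRestricted (hr : 0 ≤ r) {s c : ℝ} (h : r < s) {f : (CInf F)⟦X⟧} (hf : GaussLE s c f) :
    PowerSeries.IsRestricted r f := by
  have hs : 0 < s := hr.trans_lt h
  rw [PowerSeries.isRestricted_iff']
  refine squeeze_zero (fun n => by positivity) (g := fun n => c * (r / s) ^ n) (fun n => ?_) ?_
  · rw [div_pow, mul_div_assoc', le_div_iff₀ (by positivity)]
    calc _ = (‖PowerSeries.coeff n f‖ * s ^ n) * r ^ n := by ring
      _ ≤ _ := by
        gcongr
        exact hf n
  · simpa using (tendsto_pow_atTop_nhds_zero_of_lt_one (by positivity)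
      ((div_lt_one hs).mpr h)).const_mul c

open scoped PowerSeries.WithPiTopology in
theorem isClosed (c : ℝ) : IsClosed {f : (CInf F)⟦X⟧ | GaussLE r c f} := by
  simp only [GaussLE, Set.ofPred_forall]
  refine isClosed_iInter fun i => isClosed_le ?_ continuous_const
  exact ((PowerSeries.WithPiTopology.continuous_coeff (CInf F) i).norm).mul_const _

end GaussLE

/-! ### The function `Ω` -/

variable (F) in
/-- The factor `1 - t / θ^{q^{i+1}}` of `Ω`. -/
def omegaFactor (i : ℕ) : (CInf F)⟦X⟧ :=
  1 - PowerSeries.C (theta F ^ Fintype.card F ^ (i + 1))⁻¹ * PowerSeries.X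

open scoped PowerSeries.WithPiTopology in
variable (F) in
/-- The product `∏_{i ≥ 1} (1 - t / θ^{q^i})`. -/
def omegaProd : (CInf F)⟦X⟧ := ∏' i : ℕ, omegaFactor F i

theorem Omega_eq (ξ : CInf F) :
    Omega ξ = PowerSeries.C (ξ ^ Fintype.card F)⁻¹ * omegaProd F := rfl

theorem norm_inv_theta_pow_le (i : ℕ) :
    ‖(theta F ^ Fintype.card F ^ (i + 1))⁻¹‖ ≤ (‖theta F‖⁻¹) ^ i := by
  rw [norm_inv, norm_pow, ← inv_pow]
  refine pow_le_pow_of_le_one (by positivity) (inv_le_one_of_one_le₀ one_lt_norm_theta.le) ?_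
  exact (Nat.le_succ i).trans (Nat.lt_pow_self Fintype.one_lt_card).le

open scoped PowerSeries.WithPiTopology in
theorem multipliable_omegaFactor : Multipliable (omegaFactor F) := by
  have e : omegaFactor F = fun i => 1 +
      PowerSeries.C (-(theta F ^ Fintype.card F ^ (i + 1))⁻¹) * PowerSeries.X := by
    funext i
    rw [omegaFactor, map_neg, neg_mul, sub_eq_add_neg]
  rw [e]
  refine multipliable_one_add_of_summable_prod ?_
  refine (PowerSeries.WithPiTopology.summable_iff_summable_coeff _).mpr fun d => ?_
  have hs : Summable fun s : Finset ℕ => ∏ i ∈ s, -(theta F ^ Fintype.card F ^ (i + 1))⁻¹ := by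
    refine summable_finsetProd_of_summable_norm ?_
    simp only [norm_neg]
    exact Summable.of_nonneg_of_le (fun i => norm_nonneg _) norm_inv_theta_pow_le
      (summable_geometric_of_lt_one (by positivity) (inv_lt_one_of_one_lt₀ one_lt_norm_theta))
  -- Expanding the product, the term of a finite set `s` is a monomial of degree `|s|`, so only the
  -- sets with `d` elements contribute to the coefficient of `t^d`.
  refine (hs.indicator {s | s.card = d}).congr fun s => ?_
  rw [Finset.prod_mul_distrib, Finset.prod_const, ← map_prod, PowerSeries.coeff_C_mul,
    PowerSeries.coeff_X_pow, Set.indicator_apply]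
  by_cases h : s.card = d
  · simp [h]
  · simp [h, Ne.symm h]

open scoped PowerSeries.WithPiTopology in
theorem twist_omegaProd : twist (omegaProd F) = ∏' i, omegaFactor F (i + 1) := by
  rw [twist_eq_map, omegaProd, multipliable_omegaFactor.map_tprod _ continuous_twist]
  congr 1
  funext i
  rw [← twist_eq_map]
  simp only [omegaFactor, twist_eq_map, map_sub, map_one, map_mul, PowerSeries.map_C,
    PowerSeries.map_X, map_inv₀, map_pow, frob_apply, ← pow_mul, ← pow_succ']

open scoped PowerSeries.WithPiTopology in
theorem omegaProd_eq_mul_twist : omegaProd F = omegaFactor F 0 * twist (omegaProd F) := by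
  have h : Multipliable fun i => omegaFactor F (i + 1) := by
    have := multipliable_omegaFactor.map (PowerSeries.map (frob F)) (continuous_twist (F := F))
    refine this.congr fun i => ?_
    simp only [Function.comp_apply, omegaFactor, map_sub, map_one, map_mul, PowerSeries.map_C,
      PowerSeries.map_X, map_inv₀, map_pow, frob_apply, ← pow_mul, ← pow_succ']
  rw [twist_omegaProd, omegaProd, tprod_eq_zero_mul' h]

open scoped PowerSeries.WithPiTopology in
theorem constantCoeff_omegaProd : PowerSeries.constantCoeff (omegaProd F) = 1 := by
  rw [omegaProd, multipliable_omegaFactor.map_tprod _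
    (PowerSeries.WithPiTopology.continuous_constantCoeff (CInf F))]
  simp [omegaFactor]

open scoped PowerSeries.WithPiTopology in
-- The radius is the absolute value `|θ|^q` of the smallest zero. Each factor has Gauss norm at most
-- `1` there, and the bound survives coefficientwise limits of finite products.
theorem gaussLE_omegaProd : GaussLE (‖theta F‖ ^ Fintype.card F) 1 (omegaProd F) := by
  have hr : 0 ≤ ‖theta F‖ ^ Fintype.card F := by positivity
  refine (GaussLE.isClosed 1).mem_of_tendsto multipliable_omegaFactor.hasProd
    (.of_forall fun s => ?_)
  have hi : ∀ i ∈ s, GaussLE (‖theta F‖ ^ Fintype.card F) 1 (omegaFactor F i) := fun i _ d => by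
    rcases d with _ | _ | d
    · simp [omegaFactor]
    · rw [omegaFactor, map_sub, zero_add, PowerSeries.coeff_C_mul, PowerSeries.coeff_one_X,
        PowerSeries.coeff_one, if_neg one_ne_zero, zero_sub, norm_neg, mul_one, norm_inv, norm_pow,
        pow_one]
      refine inv_mul_le_one_of_le₀ ?_ (by positivity)
      exact pow_le_pow_right₀ one_lt_norm_theta.le (Nat.le_self_pow (Nat.succ_ne_zero i) _)
    · rw [omegaFactor, map_sub, PowerSeries.coeff_C_mul, PowerSeries.coeff_X,
        PowerSeries.coeff_one, if_neg (by omega), if_neg (by omega)]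
      simp
  simpa using GaussLE.prod hr hi

theorem theta_lt_theta_pow : ‖theta F‖ < ‖theta F‖ ^ Fintype.card F :=
  lt_self_pow₀ one_lt_norm_theta Fintype.one_lt_card

theorem ne_zero_of_pow_eq {ξ : CInf F} (hξ : ξ ^ (Fintype.card F - 1) = -theta F) : ξ ≠ 0 := by
  rintro rfl
  rw [zero_pow (Nat.sub_ne_zero_of_lt Fintype.one_lt_card), zero_eq_neg] at hξ
  exact theta_ne_zero hξ

theorem neg_one_pow_card : (-1 : CInf F) ^ Fintype.card F = -1 := by
  rw [← frob_apply, map_neg, map_one]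

/-- The twist removes the factor `1 - t/θ^q` from the product, and the choice of `ξ` gives `ξ^{-q} =
-θ^q ξ^{-q²}`; together they leave `-θ^q (1 - t/θ^q) = t - θ^q`. -/
theorem Omega_eq_mul_twist {ξ : CInf F} (hξ : ξ ^ (Fintype.card F - 1) = -theta F) :
    Omega ξ = (PowerSeries.X - PowerSeries.C (theta F ^ Fintype.card F)) * twist (Omega ξ) := by
  have h0 := ne_zero_of_pow_eq hξ
  have h1 : (ξ ^ Fintype.card F)⁻¹ = -(theta F ^ Fintype.card F) *
      ((ξ ^ Fintype.card F)⁻¹) ^ Fintype.card F := by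
    have h2 : (ξ ^ Fintype.card F) ^ Fintype.card F =
        ξ ^ Fintype.card F * (-(theta F ^ Fintype.card F)) := by
      have h3 : ξ ^ Fintype.card F = ξ * -theta F := by
        rw [← hξ, ← pow_succ', Nat.sub_add_cancel Fintype.card_pos]
      nth_rewrite 1 [h3]
      rw [mul_pow, neg_pow, neg_one_pow_card, neg_one_mul]
    have h4 : theta F ^ Fintype.card F ≠ 0 := pow_ne_zero _ theta_ne_zero
    rw [inv_pow, h2]
    field_simp
  have h2 : PowerSeries.C (theta F ^ Fintype.card F) *
      PowerSeries.C (theta F ^ Fintype.card F)⁻¹ = 1 := by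
    rw [← map_mul, mul_inv_cancel₀ (pow_ne_zero _ theta_ne_zero), map_one]
  rw [Omega_eq, twist_eq_map, map_mul, PowerSeries.map_C, ← twist_eq_map, frob_apply]
  nth_rewrite 1 [h1, omegaProd_eq_mul_twist]
  rw [omegaFactor, map_mul, map_neg, zero_add, pow_one]
  linear_combination (PowerSeries.C ((ξ ^ Fintype.card F)⁻¹ ^ Fintype.card F) *
    PowerSeries.X * twist (omegaProd F)) * h2

theorem Omega_eq_prod_mul_twist_iterate {ξ : CInf F}
    (hξ : ξ ^ (Fintype.card F - 1) = -theta F) (i : ℕ) :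
    Omega ξ = (∏ j ∈ Finset.Icc 1 i,
      (PowerSeries.X - PowerSeries.C (theta F ^ Fintype.card F ^ j))) * twist^[i] (Omega ξ) := by
  induction i with
  | zero => simp
  | succ i ih =>
    have h := congrArg twist^[i] (Omega_eq_mul_twist hξ)
    have hX : twist^[i] (PowerSeries.X - PowerSeries.C (theta F ^ Fintype.card F)) =
        PowerSeries.X - PowerSeries.C (theta F ^ Fintype.card F ^ (i + 1)) := by
      clear h ih
      induction i with
      | zero => simp
      | succ i ih =>
        rw [Function.iterate_succ_apply', ih, twist_eq_map, map_sub, PowerSeries.map_X,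
          PowerSeries.map_C, frob_apply, ← pow_mul, ← pow_succ]
    rw [twist_iterate_mul, hX, ← Function.iterate_succ_apply] at h
    rw [Finset.prod_Icc_succ_top (by omega), mul_assoc, ← h]
    exact ih

theorem gaussLE_Omega (ξ : CInf F) :
    GaussLE (‖theta F‖ ^ Fintype.card F) (‖ξ‖ ^ Fintype.card F)⁻¹ (Omega ξ) := by
  have h := (GaussLE.C (ξ ^ Fintype.card F)⁻¹).mul
    (pow_nonneg (norm_nonneg (theta F)) _) gaussLE_omegaProd
  rwa [mul_one, norm_inv, norm_pow] at h

theorem isRestricted_Omega (ξ : CInf F) : PowerSeries.IsRestricted ‖theta F‖ (Omega ξ) :=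
  (gaussLE_Omega ξ).isRestricted (norm_nonneg _) theta_lt_theta_pow

theorem constantCoeff_Omega (ξ : CInf F) :
    PowerSeries.constantCoeff (Omega ξ) = (ξ ^ Fintype.card F)⁻¹ := by
  rw [Omega_eq, map_mul, PowerSeries.constantCoeff_C, constantCoeff_omegaProd, mul_one]

theorem isRestricted_inv_Omega (ξ : CInf F) :
    PowerSeries.IsRestricted ‖theta F‖ (Omega ξ)⁻¹ := by
  rw [Omega_eq, PowerSeries.mul_inv_rev, PowerSeries.C_inv]
  refine PowerSeries.isRestricted.mul _ ?_ (PowerSeries.isRestricted_C _ _)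
  exact (gaussLE_omegaProd.inv (pow_pos (one_pos.trans one_lt_norm_theta) _)
    constantCoeff_omegaProd).isRestricted (norm_nonneg _) theta_lt_theta_pow

theorem Omega_mul_inv {ξ : CInf F} (hξ : ξ ≠ 0) : Omega ξ * (Omega ξ)⁻¹ = 1 := by
  refine PowerSeries.mul_inv_cancel _ ?_
  rw [constantCoeff_Omega]
  exact inv_ne_zero (pow_ne_zero _ hξ)

theorem hasValueAtTheta_Omega (ξ : CInf F) : HasValueAtTheta (Omega ξ) (piTilde ξ)⁻¹ := by
  rw [piTilde, inv_inv]
  exact (isRestricted_theta_iff_summable.mp (isRestricted_Omega ξ)).hasSum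

theorem piTilde_ne_zero {ξ : CInf F} (hξ : ξ ≠ 0) : piTilde ξ ≠ 0 := by
  obtain ⟨v, hv⟩ := exists_hasValueAtTheta (isRestricted_inv_Omega ξ)
  have h := (hasValueAtTheta_Omega ξ).mul hv
  rw [Omega_mul_inv hξ] at h
  intro h0
  rw [h0, inv_zero, zero_mul] at h
  exact one_ne_zero (hasValueAtTheta_one.unique h)

theorem hasValueAtTheta_inv_Omega {ξ : CInf F} (hξ : ξ ≠ 0) :
    HasValueAtTheta (Omega ξ)⁻¹ (piTilde ξ) := by
  obtain ⟨v, hv⟩ := exists_hasValueAtTheta (isRestricted_inv_Omega ξ)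
  have h := (hasValueAtTheta_Omega ξ).mul hv
  rw [Omega_mul_inv hξ] at h
  have h1 := hasValueAtTheta_one.unique h
  have h2 : v = piTilde ξ := by
    have := piTilde_ne_zero hξ
    field_simp at h1
    exact h1.symm
  rwa [← h2]

theorem norm_theta_sub_pow {j : ℕ} (hj : 1 ≤ j) :
    ‖theta F - theta F ^ Fintype.card F ^ j‖ = ‖theta F‖ ^ Fintype.card F ^ j := by
  have h : ‖theta F‖ < ‖-theta F ^ Fintype.card F ^ j‖ := by
    rw [norm_neg, norm_pow]
    exact lt_self_pow₀ one_lt_norm_theta (Nat.one_lt_pow (by omega) Fintype.one_lt_card)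
  rw [sub_eq_add_neg, IsUltrametricDist.norm_add_eq_max_of_norm_ne_norm h.ne, max_eq_right h.le,
    norm_neg, norm_pow]

theorem norm_pow_card_sub_one {ξ : CInf F} (hξ : ξ ^ (Fintype.card F - 1) = -theta F) :
    ‖ξ‖ ^ (Fintype.card F - 1) = ‖theta F‖ := by
  rw [← norm_pow, hξ, norm_neg]

/-- Here `|L_i|` is the product of the `|θ|^{q^j}` for `1 ≤ j ≤ i`, and `|θ| = |ξ|^{q-1}`, so the
exponent of `|ξ|` telescopes to `q^{i+1} - q`. -/
theorem norm_L {ξ : CInf F} (hξ : ξ ^ (Fintype.card F - 1) = -theta F) (i : ℕ) :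
    ‖L F i‖ * ‖ξ‖ ^ Fintype.card F = ‖ξ‖ ^ Fintype.card F ^ (i + 1) := by
  induction i with
  | zero => simp [L]
  | succ i ih =>
    rw [L, Finset.prod_Icc_succ_top (by omega), ← L, norm_mul, norm_theta_sub_pow (by omega),
      mul_right_comm, ih, ← norm_pow_card_sub_one hξ, ← pow_mul, ← pow_add]
    congr 1
    obtain ⟨k, hk⟩ := Nat.exists_eq_add_of_le' (Fintype.card_pos (α := F))
    rw [hk, pow_succ _ (i + 1), Nat.add_sub_cancel]
    ring

theorem one_le_norm_L (i : ℕ) : 1 ≤ ‖L F i‖ := by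
  rw [L, norm_prod]
  refine Finset.prod_induction _ (1 ≤ ·) (fun _ _ => one_le_mul_of_one_le_of_one_le) le_rfl
    fun j hj => ?_
  rw [norm_theta_sub_pow (Finset.mem_Icc.mp hj).1]
  exact one_le_pow₀ one_lt_norm_theta.le

theorem L_ne_zero (i : ℕ) : L F i ≠ 0 := norm_pos_iff.mp (one_pos.trans_le (one_le_norm_L i))

theorem isRestricted_twist_iterate {f : (CInf F)⟦X⟧}
    (hf : PowerSeries.IsRestricted ‖theta F‖ f) (i : ℕ) :
    PowerSeries.IsRestricted ‖theta F‖ (twist^[i] f) := by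
  induction i with
  | zero => exact hf
  | succ i ih =>
    rw [Function.iterate_succ_apply']
    exact isRestricted_twist one_lt_norm_theta.le ih

theorem hasValueAtTheta_twist_iterate_Omega {ξ : CInf F}
    (hξ : ξ ^ (Fintype.card F - 1) = -theta F) (i : ℕ) :
    HasValueAtTheta (twist^[i] (Omega ξ)) ((piTilde ξ)⁻¹ / L F i) := by
  obtain ⟨v, hv⟩ := exists_hasValueAtTheta (isRestricted_twist_iterate (isRestricted_Omega ξ) i)
  have h1 : HasValueAtTheta (∏ j ∈ Finset.Icc 1 i,
      (PowerSeries.X - PowerSeries.C (theta F ^ Fintype.card F ^ j))) (L F i) :=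
    HasValueAtTheta.prod fun j _ => hasValueAtTheta_X.sub (hasValueAtTheta_C _)
  have h2 := h1.mul hv
  rw [← Omega_eq_prod_mul_twist_iterate hξ] at h2
  rw [(hasValueAtTheta_Omega ξ).unique h2, mul_div_cancel_left₀ _ (L_ne_zero i)]
  exact hv

/-! ### Solutions of the system -/

theorem inTate_one : InTate (1 : (CInf F)⟦X⟧) := PowerSeries.isRestricted_one 1

theorem inTate_zero : InTate (0 : (CInf F)⟦X⟧) := PowerSeries.isRestricted_zero 1

theorem twist_one : twist (1 : (CInf F)⟦X⟧) = 1 := by rw [twist_eq_map, map_one]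

theorem twist_zero : twist (0 : (CInf F)⟦X⟧) = 0 := by rw [twist_eq_map, map_zero]

theorem twist_add (f g : (CInf F)⟦X⟧) : twist (f + g) = twist f + twist g := by
  simp only [twist_eq_map, map_add]

/-- The power series in the Tate algebra fixed by the twist are the polynomials over `𝔽_q`. -/
theorem exists_eq_smul_one {f : (CInf F)⟦X⟧} (hf : InTate f) (h : f - twist f = 0) :
    ∃ p : F[X], f = p • (1 : (CInf F)⟦X⟧) := by
  have hc : ∀ i, ∃ c : F, algebraMap F (CInf F) c = PowerSeries.coeff i f := fun i => by
    refine exists_algebraMap_eq ?_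
    rw [frob_apply, ← coeff_twist, ← sub_eq_zero.mp h]
  choose c hc using hc
  obtain ⟨N, hN⟩ := eventually_atTop.mp
    ((tendsto_norm_coeff le_rfl hf).eventually (gt_mem_nhds one_pos))
  have hz : ∀ i, N ≤ i → c i = 0 := fun i hi => by
    by_contra h0
    have h1 := hN i hi
    rw [← hc, norm_algebraMap h0] at h1
    exact lt_irrefl _ h1
  refine ⟨∑ i ∈ Finset.range N, monomial i (c i), ?_⟩
  ext i
  rw [Algebra.smul_def, mul_one, PowerSeries.algebraMap_apply', PowerSeries.coeff_map,
    Polynomial.coeff_coe, Polynomial.finsetSum_coeff]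
  simp only [coeff_monomial, Finset.sum_ite_eq', Finset.mem_range]
  split_ifs with hi
  · exact (hc i).symm
  · rw [map_zero, ← hc, hz i (not_lt.mp hi), map_zero]

section Solutions

variable {k : ℕ} {Z : Fin k → (CInf F)⟦X⟧} {f : Fin (k + 1) → (CInf F)⟦X⟧}

theorem IsSolution.inTate (hf : IsSolution Z f) (i : Fin (k + 1)) : InTate (f i) := by
  refine Fin.cases ?_ (fun i => (hf.2 i).1) i
  rw [hf.1]
  exact inTate_one

/-- Only invariance of `f 0` under the twist is required, so that the statement serves both
normalised solutions (`f 0 = 1`) and homogeneous ones. -/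
theorem isRestricted_of_system (hZ : ∀ i, PowerSeries.IsRestricted ‖theta F‖ (Z i))
    (hf : ∀ i, InTate (f i)) (h0 : f 0 - twist (f 0) = 0)
    (h : ∀ i : Fin k, f i.succ - twist (f i.succ) = Z i.rev * twist (f i.castSucc))
    (i : Fin (k + 1)) : PowerSeries.IsRestricted ‖theta F‖ (f i) := by
  induction i using Fin.induction with
  | zero =>
    refine isRestricted_of_sub_twist (hf 0) ?_
    rw [h0]
    exact PowerSeries.isRestricted_zero _
  | succ i ih =>
    refine isRestricted_of_sub_twist (hf i.succ) ?_
    rw [h i]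
    exact PowerSeries.isRestricted.mul _ (hZ _) (isRestricted_twist one_lt_norm_theta.le ih)

theorem IsSolution.isRestricted (hZ : ∀ i, PowerSeries.IsRestricted ‖theta F‖ (Z i))
    (hf : IsSolution Z f) (i : Fin (k + 1)) : PowerSeries.IsRestricted ‖theta F‖ (f i) :=
  isRestricted_of_system hZ hf.inTate (by rw [hf.1, twist_one, sub_self]) (fun i => (hf.2 i).2) i

theorem exists_sequence_solution {W : ℕ → (CInf F)⟦X⟧} (hW : ∀ i, InTate (W i)) :
    ∃ f : ℕ → (CInf F)⟦X⟧, f 0 = 1 ∧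
      ∀ i, InTate (f i) ∧ f (i + 1) - twist (f (i + 1)) = W i * twist (f i) := by
  have h : ∀ (i : ℕ) (x : {x : (CInf F)⟦X⟧ // InTate x}), ∃ y : {y : (CInf F)⟦X⟧ // InTate y},
      y.1 - twist y.1 = W i * twist x.1 := fun i x => by
    obtain ⟨y, hy, e⟩ := exists_sub_twist_eq
      (PowerSeries.isRestricted.mul 1 (hW i) (isRestricted_twist le_rfl x.2))
    exact ⟨⟨y, hy⟩, e⟩
  choose Y hY using h
  obtain ⟨u, hu0, hu⟩ : ∃ u : ℕ → {x : (CInf F)⟦X⟧ // InTate x}, u 0 = ⟨1, inTate_one⟩ ∧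
      ∀ i, u (i + 1) = Y i (u i) :=
    ⟨fun i => Nat.rec ⟨1, inTate_one⟩ Y i, rfl, fun i => rfl⟩
  refine ⟨fun i => (u i).1, congrArg Subtype.val hu0, fun i => ⟨(u i).2, ?_⟩⟩
  simp only [hu]
  exact hY i (u i)

theorem exists_isSolution (hZ : ∀ i, InTate (Z i)) : ∃ f, IsSolution Z f := by
  obtain ⟨f, h0, hf⟩ := exists_sequence_solution
    -- The system is prolonged by zero coefficients to an infinite one, where solutions are built by
    -- plain recursion.
    (W := fun i => if h : i < k then Z (Fin.rev ⟨i, h⟩) else 0) fun i => by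
      split_ifs
      · exact hZ _
      · exact inTate_zero
  refine ⟨fun i => f i, h0, fun i => ⟨(hf _).1, ?_⟩⟩
  have h := (hf i).2
  rw [dif_pos i.2] at h
  exact h

end Solutions

/-! ### The homogeneous system and its generators -/

section Homogeneous

variable {m : ℕ} {Z : Fin m → (CInf F)⟦X⟧} {g : Fin (m + 1) → (CInf F)⟦X⟧}

/-- The solutions in the Tate algebra of the homogeneous system. -/
def homogeneousSolutions (Z : Fin m → (CInf F)⟦X⟧) :
    Submodule F[X] (Fin (m + 1) → (CInf F)⟦X⟧) where
  carrier := {g | (∀ j, InTate (g j)) ∧ g 0 - twist (g 0) = 0 ∧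
    ∀ i : Fin m, g i.succ - twist (g i.succ) = Z i.rev * twist (g i.castSucc)}
  zero_mem' := by
    refine ⟨fun j => inTate_zero, ?_, fun i => ?_⟩ <;> simp [twist_zero]
  add_mem' := by
    rintro g h ⟨hg1, hg2, hg3⟩ ⟨hh1, hh2, hh3⟩
    refine ⟨fun j => PowerSeries.isRestricted.add 1 (hg1 j) (hh1 j), ?_, fun i => ?_⟩
    · simp only [Pi.add_apply, twist_add]
      linear_combination hg2 + hh2
    · simp only [Pi.add_apply, twist_add]
      linear_combination hg3 i + hh3 i
  smul_mem' := by
    rintro p g ⟨hg1, hg2, hg3⟩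
    refine ⟨fun j => isRestricted_smul (hg1 j) p, ?_, fun i => ?_⟩
    · simp only [Pi.smul_apply, twist_smul]
      rw [← smul_sub, hg2, smul_zero]
    · simp only [Pi.smul_apply, twist_smul]
      rw [← smul_sub, hg3, mul_smul_comm]

theorem mem_homogeneousSolutions : g ∈ homogeneousSolutions Z ↔
    (∀ j, InTate (g j)) ∧ g 0 - twist (g 0) = 0 ∧
      ∀ i : Fin m, g i.succ - twist (g i.succ) = Z i.rev * twist (g i.castSucc) := Iff.rfl

theorem isRestricted_of_mem_homogeneousSolutions
    (hZ : ∀ i, PowerSeries.IsRestricted ‖theta F‖ (Z i)) (hg : g ∈ homogeneousSolutions Z)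
    (j : Fin (m + 1)) : PowerSeries.IsRestricted ‖theta F‖ (g j) :=
  isRestricted_of_system hZ hg.1 hg.2.1 hg.2.2 j

theorem pad_mem_homogeneousSolutions {k : Fin (m + 1)} {f : Fin (k + 1) → (CInf F)⟦X⟧}
    (hf : IsSolution (fun l : Fin k => Z ⟨l, by omega⟩) f) :
    pad k f ∈ homogeneousSolutions Z := by
  have hone : (1 : (CInf F)⟦X⟧) - twist 1 = 0 := by rw [twist_one, sub_self]
  have hk := k.2
  refine ⟨fun j => ?_, ?_, fun i => ?_⟩
  · rw [pad]
    split_ifs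
    · exact inTate_zero
    · exact hf.inTate _
  · rw [pad]
    split_ifs with h
    · rw [twist_zero, sub_zero]
    · have e : (⟨((0 : Fin (m + 1)) : ℕ) + k - m, by omega⟩ : Fin (k + 1)) = 0 :=
        Fin.ext (by simp; omega)
      rw [e, hf.1, hone]
  · have hi := i.2
    -- The equation lies inside the block of zeros, at the entry `1` preceded by `0`, or inside the
    -- given solution.
    rcases lt_trichotomy ((i : ℕ) + 1 + k) m with h | h | h
    · have h1 : pad k f i.succ = 0 := if_pos (by simpa using h)
      have h2 : pad k f i.castSucc = 0 := if_pos (by simp; omega)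
      rw [h1, h2, twist_zero, sub_zero, mul_zero]
    · have h1 : pad k f i.succ = 1 := by
        rw [pad, if_neg (by simp; omega), ← hf.1]
        exact congrArg f (Fin.ext (by simp; omega))
      have h2 : pad k f i.castSucc = 0 := if_pos (by simp; omega)
      rw [h1, h2, hone, twist_zero, mul_zero]
    · obtain ⟨l, hl⟩ : ∃ l : Fin k, (l : ℕ) = i + k - m := ⟨⟨i + k - m, by omega⟩, rfl⟩
      have h1 : pad k f i.succ = f l.succ := by
        rw [pad, if_neg (by simp; omega)]
        exact congrArg f (Fin.ext (by simp; omega))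
      have h2 : pad k f i.castSucc = f l.castSucc := by
        rw [pad, if_neg (by simp; omega)]
        exact congrArg f (Fin.ext (by simp; omega))
      rw [h1, h2, (hf.2 l).2]
      exact congrArg (· * _) (congrArg Z (Fin.ext (by simp only [Fin.val_rev]; omega)))

theorem sub_twist_eq_zero_of_forall_lt (hg : g ∈ homogeneousSolutions Z) {s : Fin (m + 1)}
    (h : ∀ j < s, g j = 0) : g s - twist (g s) = 0 := by
  rcases Fin.eq_zero_or_eq_succ s with rfl | ⟨i, rfl⟩
  · exact hg.2.1
  · rw [hg.2.2 i, h _ (Fin.castSucc_lt_succ), twist_zero, mul_zero]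

/-- The leading component of a homogeneous solution is a polynomial `p` over `𝔽_q`; subtracting `p`
times a generator with leading entry `1` in the same place removes it. -/
theorem tMonodromyZero_eq (hZ : ∀ i, InTate (Z i)) :
    tMonodromyZero Z = homogeneousSolutions Z := by
  refine le_antisymm (Submodule.span_le.mpr ?_) fun g hg => ?_
  · rintro g ⟨k, f, hf, rfl⟩
    exact pad_mem_homogeneousSolutions hf
  -- Induction on the number `r` of final components that are allowed to be nonzero.
  suffices h : ∀ r : ℕ, ∀ g ∈ homogeneousSolutions Z,
      (∀ j : Fin (m + 1), (j : ℕ) + r < m + 1 → g j = 0) → g ∈ tMonodromyZero Z from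
    h (m + 1) g hg fun j hj => by omega
  intro r
  induction r with
  | zero =>
    intro g _ h0
    have : g = 0 := funext fun j => h0 j (by omega)
    rw [this]
    exact Submodule.zero_mem _
  | succ r ih =>
    intro g hg h0
    by_cases hr : r ≤ m
    · obtain ⟨k, hk⟩ : ∃ k : Fin (m + 1), (k : ℕ) = r := ⟨⟨r, by omega⟩, rfl⟩
      obtain ⟨s, hs⟩ : ∃ s : Fin (m + 1), (s : ℕ) = m - r := ⟨⟨m - r, by omega⟩, rfl⟩
      obtain ⟨f, hf⟩ := exists_isSolution (Z := fun l : Fin k => Z ⟨l, by omega⟩) fun l => hZ _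
      obtain ⟨p, hp⟩ := exists_eq_smul_one (hg.1 s) (sub_twist_eq_zero_of_forall_lt hg fun j hj =>
        h0 j (by have : (j : ℕ) < s := hj; omega))
      have hmem : pad k f ∈ tMonodromyZero Z := Submodule.subset_span ⟨k, f, hf, rfl⟩
      have hd := ih (g - p • pad k f)
        (Submodule.sub_mem _ hg (Submodule.smul_mem _ p (pad_mem_homogeneousSolutions hf)))
        fun j hj => by
          rw [Pi.sub_apply, Pi.smul_apply]
          rcases Nat.lt_or_ge ((j : ℕ) + r) m with hlt | hge
          · have h1 : pad k f j = 0 := if_pos (by omega)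
            rw [h1, smul_zero, sub_zero]
            exact h0 j (by omega)
          · have hj : j = s := Fin.ext (by omega)
            have h1 : pad k f j = 1 := by
              rw [pad, if_neg (by omega), ← hf.1]
              exact congrArg f (Fin.ext (by simp; omega))
            rw [h1, hj, hp, sub_self]
      have := Submodule.add_mem _ hd (Submodule.smul_mem _ p hmem)
      rwa [sub_add_cancel] at this
    · exact ih g hg fun j hj => by omega

theorem eq_zero_of_norm_value_lt_one (hg : g ∈ homogeneousSolutions Z) {v : Fin (m + 1) → CInf F}
    (hv : ∀ j, HasValueAtTheta (g j) (v j)) (h : ∀ j, ‖v j‖ < 1) : g = 0 := by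
  have key : ∀ s, (∀ j < s, g j = 0) → g s = 0 := fun s hs => by
    obtain ⟨p, hp⟩ := exists_eq_smul_one (hg.1 s) (sub_twist_eq_zero_of_forall_lt hg hs)
    have h1 := hasValueAtTheta_one.smul (F := F) p
    rw [← hp, mul_one] at h1
    have h2 : p = 0 := by
      by_contra h0
      have h3 := h s
      rw [(hv s).unique h1] at h3
      exact h3.not_ge (one_le_norm_aeval_theta h0)
    rw [hp, h2, zero_smul]
  funext s
  induction s using WellFoundedLT.induction with
  | _ s ih => exact key s ih

end Homogeneous

/-! ### Branch values and the monodromy module -/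

theorem hasValueAtTheta_inv_Omega_pow_mul_iff {ξ : CInf F} (hξ : ξ ≠ 0) (N : ℕ)
    (f : (CInf F)⟦X⟧) (v : CInf F) :
    HasValueAtTheta ((Omega ξ)⁻¹ ^ N * f) v ↔ HasValueAtTheta f ((piTilde ξ)⁻¹ ^ N * v) := by
  constructor
  · intro h
    have := ((hasValueAtTheta_Omega ξ).pow N).mul h
    rwa [← mul_assoc, ← mul_pow, Omega_mul_inv hξ, one_pow, one_mul] at this
  · intro h
    have := ((hasValueAtTheta_inv_Omega hξ).pow N).mul h
    rwa [← mul_assoc, ← mul_pow, mul_inv_cancel₀ (piTilde_ne_zero hξ), one_pow, one_mul] at this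

theorem isRestricted_Omega_pow_mul_C (ξ : CInf F) (n : ℕ) (a : CInf F) :
    PowerSeries.IsRestricted ‖theta F‖ (Omega ξ ^ n * PowerSeries.C a) :=
  PowerSeries.isRestricted.mul _ (isRestricted_pow (isRestricted_Omega ξ) n)
    (PowerSeries.isRestricted_C _ a)

section Branch

variable {ξ : CInf F} {m : ℕ} {n : Fin (m + 1) → ℕ} {z : Fin m → CInf F}

/-- The tuples in the Tate algebra solving the system whose first equation has right hand side
`Ω^{n_d} w`. -/
def InhomogeneousSolution (ξ : CInf F) (n : Fin (m + 1) → ℕ) (z : Fin m → CInf F) (w : CInf F)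
    (g : Fin (m + 1) → (CInf F)⟦X⟧) : Prop :=
  (∀ j, InTate (g j)) ∧
    g 0 - twist (g 0) = Omega ξ ^ n (Fin.last m) * PowerSeries.C w ∧
    ∀ i : Fin m, g i.succ - twist (g i.succ) =
      Omega ξ ^ n i.rev.castSucc * PowerSeries.C (z i.rev) * twist (g i.castSucc)

/-- Dropping the normalised entry `f 0 = 1` makes the system linear in the pair consisting of `w`
and the unknowns. -/
theorem isSolution_snoc_iff (w : CInf F) (f : Fin (m + 2) → (CInf F)⟦X⟧) :
    IsSolution (fun i => Omega ξ ^ n i *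
      PowerSeries.C ((Fin.snoc z w : Fin (m + 1) → CInf F) i)) f ↔
      f 0 = 1 ∧ InhomogeneousSolution ξ n z w fun j => f j.succ := by
  refine and_congr_right fun h0 => ?_
  rw [Fin.forall_fin_succ, InhomogeneousSolution, Fin.forall_fin_succ]
  simp only [Fin.rev_zero, Fin.snoc_last, Fin.rev_succ, Fin.snoc_castSucc, Fin.castSucc_zero, h0,
    twist_one, mul_one, ← Fin.succ_castSucc]
  constructor
  · rintro ⟨⟨h1, h2⟩, h3⟩
    exact ⟨⟨h1, fun i => (h3 i).1⟩, h2, fun i => (h3 i).2⟩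
  · rintro ⟨⟨h1, h2⟩, h3, h4⟩
    exact ⟨⟨h1, h3⟩, fun i => ⟨h2 i, h4 i⟩⟩

theorem isBranchValue_snoc_iff (hξ : ξ ≠ 0) (w : CInf F) (v : Fin (m + 1) → CInf F) :
    IsBranchValue ξ n (Fin.snoc z w : Fin (m + 1) → CInf F) v ↔
      ∃ g, InhomogeneousSolution ξ n z w g ∧
        ∀ j, HasValueAtTheta (g j) ((piTilde ξ)⁻¹ ^ (∑ i, n i) * v j) := by
  simp only [IsBranchValue, isSolution_snoc_iff, hasValueAtTheta_inv_Omega_pow_mul_iff hξ]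
  constructor
  · rintro ⟨f, ⟨-, hf⟩, hv⟩
    exact ⟨_, hf, hv⟩
  · rintro ⟨g, hg, hv⟩
    exact ⟨Fin.cons 1 g, ⟨Fin.cons_zero _ _, by simpa only [Fin.cons_succ] using hg⟩,
      by simpa only [Fin.cons_succ] using hv⟩

theorem tMonodromyZero_Omega_eq : tMonodromyZero
    (fun i : Fin m => Omega ξ ^ n i.castSucc * PowerSeries.C (z i)) =
      homogeneousSolutions fun i => Omega ξ ^ n i.castSucc * PowerSeries.C (z i) :=
  tMonodromyZero_eq fun _ => inTate_of_isRestricted (isRestricted_Omega_pow_mul_C _ _ _)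

theorem mem_tMonodromy_iff {g : Fin (m + 1) → (CInf F)⟦X⟧} : g ∈ tMonodromy ξ n z ↔
    ∃ h ∈ homogeneousSolutions fun i => Omega ξ ^ n i.castSucc * PowerSeries.C (z i),
      (fun j => (Omega ξ)⁻¹ ^ (∑ i, n i) * h j) = g := by
  rw [tMonodromy, tMonodromyZero_Omega_eq]
  exact Submodule.mem_map

theorem exists_hasValueAtTheta_of_mem_tMonodromy {g : Fin (m + 1) → (CInf F)⟦X⟧}
    (hg : g ∈ tMonodromy ξ n z) (j : Fin (m + 1)) : ∃ v, HasValueAtTheta (g j) v := by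
  obtain ⟨h, hh, e⟩ := mem_tMonodromy_iff.mp hg
  have hr := isRestricted_of_mem_homogeneousSolutions
    (fun i => isRestricted_Omega_pow_mul_C ξ (n i.castSucc) (z i)) hh j
  rw [← e]
  exact exists_hasValueAtTheta (PowerSeries.isRestricted.mul _
    (isRestricted_pow (isRestricted_inv_Omega ξ) _) hr)

theorem mem_monodromy_iff (hξ : ξ ≠ 0) {v : Fin (m + 1) → CInf F} : v ∈ monodromy ξ n z ↔
    ∃ g ∈ homogeneousSolutions fun i => Omega ξ ^ n i.castSucc * PowerSeries.C (z i),
      ∀ j, HasValueAtTheta (g j) ((piTilde ξ)⁻¹ ^ (∑ i, n i) * v j) := by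
  change (∃ g ∈ tMonodromy ξ n z, ∀ j, HasValueAtTheta (g j) (v j)) ↔ _
  simp only [mem_tMonodromy_iff, ← hasValueAtTheta_inv_Omega_pow_mul_iff hξ]
  constructor
  · rintro ⟨_, ⟨h, hh, rfl⟩, hv⟩
    exact ⟨h, hh, hv⟩
  · rintro ⟨h, hh, hv⟩
    exact ⟨_, ⟨h, hh, rfl⟩, hv⟩

/-- The monodromy module consists of the branch values at `z_d = 0`. -/
theorem mem_monodromy_iff_isBranchValue (hξ : ξ ≠ 0) {v : Fin (m + 1) → CInf F} :
    v ∈ monodromy ξ n z ↔ IsBranchValue ξ n (Fin.snoc z 0 : Fin (m + 1) → CInf F) v := by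
  rw [mem_monodromy_iff hξ, isBranchValue_snoc_iff hξ]
  simp only [mem_homogeneousSolutions, InhomogeneousSolution, map_zero, mul_zero]

theorem IsBranchValue.add (hξ : ξ ≠ 0) {w w' : CInf F} {v v' : Fin (m + 1) → CInf F}
    (hv : IsBranchValue ξ n (Fin.snoc z w : Fin (m + 1) → CInf F) v)
    (hv' : IsBranchValue ξ n (Fin.snoc z w' : Fin (m + 1) → CInf F) v') :
    IsBranchValue ξ n (Fin.snoc z (w + w') : Fin (m + 1) → CInf F) (v + v') := by
  rw [isBranchValue_snoc_iff hξ] at hv hv' ⊢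
  obtain ⟨g, ⟨h1, h2, h3⟩, hg⟩ := hv
  obtain ⟨g', ⟨h1', h2', h3'⟩, hg'⟩ := hv'
  refine ⟨g + g', ⟨fun j => PowerSeries.isRestricted.add 1 (h1 j) (h1' j), ?_, fun i => ?_⟩,
    fun j => ?_⟩
  · rw [Pi.add_apply, twist_add, map_add]
    linear_combination h2 + h2'
  · rw [Pi.add_apply, Pi.add_apply, twist_add, twist_add]
    linear_combination h3 i + h3' i
  · rw [Pi.add_apply, Pi.add_apply, mul_add]
    exact (hg j).add (hg' j)

theorem IsBranchValue.smul (hξ : ξ ≠ 0) {w : CInf F} {v : Fin (m + 1) → CInf F}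
    (hv : IsBranchValue ξ n (Fin.snoc z w : Fin (m + 1) → CInf F) v) (c : F) :
    IsBranchValue ξ n (Fin.snoc z (c • w) : Fin (m + 1) → CInf F) (c • v) := by
  rw [isBranchValue_snoc_iff hξ] at hv ⊢
  obtain ⟨g, ⟨h1, h2, h3⟩, hg⟩ := hv
  refine ⟨fun j => (Polynomial.C c : F[X]) • g j, ⟨fun j => isRestricted_smul (h1 j) _, ?_,
    fun i => ?_⟩, fun j => ?_⟩
  · rw [twist_smul, ← smul_sub, h2, C_smul_eq, Algebra.smul_def, map_mul]
    ring
  · rw [twist_smul, twist_smul, ← smul_sub, h3, mul_smul_comm]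
  · have := (hg j).smul (Polynomial.C c)
    rwa [aeval_C, mul_left_comm, ← Algebra.smul_def] at this

theorem exists_isBranchValue (ξ : CInf F) (n : Fin (m + 1) → ℕ) (z : Fin (m + 1) → CInf F) :
    ∃ v, IsBranchValue ξ n z v := by
  have hZ := fun i => isRestricted_Omega_pow_mul_C ξ (n i) (z i)
  obtain ⟨f, hf⟩ := exists_isSolution fun i => inTate_of_isRestricted (hZ i)
  have hv : ∀ j : Fin (m + 1), ∃ v, HasValueAtTheta ((Omega ξ)⁻¹ ^ (∑ i, n i) * f j.succ) v :=
    fun j => exists_hasValueAtTheta <| PowerSeries.isRestricted.mul _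
      (isRestricted_pow (isRestricted_inv_Omega ξ) _) (hf.isRestricted hZ _)
  choose v hv using hv
  exact ⟨v, f, hf, hv⟩

/-- By additivity the difference of two branch values at `w` is a branch value at `0`, hence lies in
`M`; conversely, adding an element of `M` to a branch value at `w` gives another one. -/
theorem isBranchValue_iff_mk_eq_contCMPL (hξ : ξ ≠ 0) (w : CInf F) (v : Fin (m + 1) → CInf F) :
    IsBranchValue ξ n (Fin.snoc z w : Fin (m + 1) → CInf F) v ↔
      Submodule.Quotient.mk v = contCMPL ξ n z w := by
  have he := Classical.epsilon_spec
    (exists_isBranchValue ξ n (Fin.snoc z w : Fin (m + 1) → CInf F))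
  rw [contCMPL, Submodule.Quotient.eq, mem_monodromy_iff_isBranchValue hξ]
  constructor
  · intro hv
    have h := hv.add hξ (he.smul hξ (-1 : F))
    simpa only [neg_smul, one_smul, ← sub_eq_add_neg, sub_self] using h
  · intro hv
    have h := hv.add hξ he
    rwa [zero_add, sub_add_cancel] at h

theorem isBranchValue_epsilon (hξ : ξ ≠ 0) (w : CInf F) :
    ∃ v, IsBranchValue ξ n (Fin.snoc z w : Fin (m + 1) → CInf F) v ∧
      contCMPL ξ n z w = Submodule.Quotient.mk v :=
  (exists_isBranchValue ξ n (Fin.snoc z w : Fin (m + 1) → CInf F)).imp fun v hv =>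
    ⟨hv, ((isBranchValue_iff_mk_eq_contCMPL hξ w v).mp hv).symm⟩

theorem isLinearMap_contCMPL (hξ : ξ ≠ 0) : IsLinearMap F (contCMPL ξ n z) where
  map_add w w' := by
    obtain ⟨v, hv, e⟩ := isBranchValue_epsilon (n := n) (z := z) hξ w
    obtain ⟨v', hv', e'⟩ := isBranchValue_epsilon (n := n) (z := z) hξ w'
    rw [e, e', ← Submodule.Quotient.mk_add]
    exact ((isBranchValue_iff_mk_eq_contCMPL hξ _ _).mp (hv.add hξ hv')).symm
  map_smul c w := by
    obtain ⟨v, hv, e⟩ := isBranchValue_epsilon (n := n) (z := z) hξ w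
    rw [e, ← Submodule.Quotient.mk_smul]
    exact ((isBranchValue_iff_mk_eq_contCMPL hξ _ _).mp (hv.smul hξ c)).symm

/-! ### Discreteness -/

theorem exists_norm_lt_eq_zero_of_mem_monodromy (hξ : ξ ≠ 0) :
    ∃ ε > 0, ∀ v ∈ monodromy ξ n z, ‖v‖ < ε → v = 0 := by
  have hp := piTilde_ne_zero hξ
  -- Dividing by `π̃^N` undoes the scaling by `Ω^{-N}`, so the threshold `1` for homogeneous
  -- solutions becomes `|π̃|^N`.
  refine ⟨‖piTilde ξ ^ ∑ i, n i‖, norm_pos_iff.mpr (pow_ne_zero _ hp), fun v hv hlt => ?_⟩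
  obtain ⟨g, hg, hgv⟩ := (mem_monodromy_iff hξ).mp hv
  have h0 : g = 0 := eq_zero_of_norm_value_lt_one hg hgv fun j => by
    rw [norm_mul, inv_pow, norm_inv, inv_mul_lt_one₀ (norm_pos_iff.mpr (pow_ne_zero _ hp))]
    exact (norm_le_pi_norm v j).trans_lt hlt
  funext j
  have h1 := hgv j
  rw [h0] at h1
  have h2 : HasValueAtTheta ((0 : Fin (m + 1) → (CInf F)⟦X⟧) j) 0 := by simp [HasValueAtTheta]
  exact (mul_eq_zero.mp (h1.unique h2)).resolve_left (pow_ne_zero _ (inv_ne_zero hp))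

theorem discreteTopology_monodromy (hξ : ξ ≠ 0) : DiscreteTopology (monodromy ξ n z) := by
  obtain ⟨ε, hε, h⟩ := exists_norm_lt_eq_zero_of_mem_monodromy (n := n) (z := z) hξ
  refine discreteTopology_of_isOpen_singleton_zero ?_
  have e : ({0} : Set (monodromy ξ n z)) =
      Subtype.val ⁻¹' Metric.ball (0 : Fin (m + 1) → CInf F) ε := by
    ext ⟨v, hv⟩
    rw [Set.mem_singleton_iff, Set.mem_preimage, mem_ball_zero_iff]
    constructor
    · intro h0
      rw [congrArg Subtype.val h0]
      simpa using hε
    · exact fun hlt => Subtype.ext (h v hv hlt)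
  rw [e]
  exact Metric.isOpen_ball.preimage continuous_subtype_val

end Branch

/-! ### Strictly increasing tuples of indices -/

section Indices

variable {a : ℕ}

/-- The tuple `(i_1 + 1, …, i_a + 1)`. -/
def Idx.shift (i : Idx a) : Idx a := ⟨fun k => i.1 k + 1, fun _ _ h => Nat.succ_lt_succ (i.2 h)⟩

/-- The tuple `(0, i_1 + 1, …, i_a + 1)`. -/
def Idx.cons (i : Idx a) : Idx (a + 1) :=
  ⟨Fin.cons 0 fun k => i.1 k + 1, by
    intro k l
    refine Fin.cases ?_ (fun k => ?_) k <;> refine Fin.cases ?_ (fun l => ?_) l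
    · exact fun h => absurd h (lt_irrefl _)
    · intro
      simp
    · exact fun h => absurd h (Fin.not_lt_zero _)
    · intro h
      simpa using i.2 (Fin.succ_lt_succ_iff.mp h)⟩

theorem Idx.shift_injective : Function.Injective (Idx.shift (a := a)) := fun _ _ h =>
  Subtype.ext (funext fun k => Nat.succ_injective (congrFun (congrArg Subtype.val h) k))

theorem Idx.cons_injective : Function.Injective (Idx.cons (a := a)) := fun _ _ h =>
  Subtype.ext (funext fun k => Nat.succ_injective (by
    simpa [Idx.cons] using congrFun (congrArg Subtype.val h) k.succ))

theorem Idx.isCompl_range :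
    IsCompl (Set.range (Idx.cons (a := a))) (Set.range (Idx.shift (a := a + 1))) := by
  rw [isCompl_iff, Set.disjoint_iff, codisjoint_iff_le_sup]
  constructor
  · rintro _ ⟨⟨i, rfl⟩, j, hj⟩
    exact absurd (congrFun (congrArg Subtype.val hj) 0) (Nat.succ_ne_zero _)
  · rintro i -
    rcases Nat.eq_zero_or_pos (i.1 0) with h | h
    · have hp : ∀ k : Fin a, 0 < i.1 k.succ := fun k => by
        rw [← h]
        exact i.2 (Fin.succ_pos k)
      refine Or.inl ⟨⟨fun k => i.1 k.succ - 1, fun k l hkl => ?_⟩, Subtype.ext (funext fun k => ?_)⟩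
      · have := i.2 (Fin.succ_lt_succ_iff.mpr hkl)
        have := hp k
        simp only
        omega
      · refine Fin.cases ?_ (fun k => ?_) k
        · exact h.symm
        · exact Nat.succ_pred_eq_of_pos (hp k)
    · have hp : ∀ k : Fin (a + 1), 0 < i.1 k := fun k =>
        h.trans_le (i.2.monotone (Fin.zero_le k))
      refine Or.inr ⟨⟨fun k => i.1 k - 1, fun k l hkl => ?_⟩, Subtype.ext (funext fun k => ?_)⟩
      · have := i.2 hkl
        have := hp k
        simp only
        omega
      · exact Nat.succ_pred_eq_of_pos (hp k)

/-- Only finitely many increasing tuples have a bounded last entry. The limit that defines `𝔻` is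
thus the one that governs ultrametric summability. -/
theorem Idx.comap_last_atTop (m : ℕ) :
    comap (fun i : Idx (m + 1) => i.1 (Fin.last m)) atTop = cofinite := by
  refine le_antisymm ?_ (tendsto_iff_comap.mp (tendsto_atTop.mpr fun N => ?_))
  · rw [← Nat.cofinite_eq_atTop]
    exact comap_cofinite_le _
  · rw [eventually_cofinite]
    have hf : (Set.Iic fun _ : Fin (m + 1) => N).Finite := Set.finite_Iic _
    refine (hf.preimage (Subtype.val_injective (p := StrictMono)).injOn).subset fun i hi k => ?_
    exact (i.2.monotone (Fin.le_last k)).trans (not_le.mp hi).le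

end Indices

/-- The last `a` entries of an `M`-tuple. -/
def lastN {α : Type*} {M a : ℕ} (h : a ≤ M) (x : Fin M → α) : Fin a → α :=
  fun l => x ⟨M - a + l, by omega⟩

theorem tail_lastN {α : Type*} {M a : ℕ} (h : a + 1 ≤ M) (x : Fin M → α) :
    Fin.tail (lastN h x) = lastN (Nat.le_of_succ_le h) x :=
  funext fun l => congrArg x (Fin.ext (by simp; omega))

theorem lastEntries_eq_lastN {α : Type*} {m : ℕ} (j : Fin (m + 1)) (x : Fin (m + 1) → α) :
    lastEntries j x = lastN (Nat.succ_le_of_lt j.2) x :=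
  funext fun l => congrArg x (Fin.ext (by simp))

/-! ### The deformed series -/

section Weight

variable {a : ℕ}

set_option linter.unusedSectionVars false

variable (F) in
/-- The monomial `∏_k x_k^{q^{i_k}}`. -/
def weight {R : Type*} [CommMonoid R] (x : Fin a → R) (i : Idx a) : R :=
  ∏ k, x k ^ Fintype.card F ^ i.1 k

theorem weight_cons {R : Type*} [CommMonoid R] (x : Fin (a + 1) → R) (i : Idx a) :
    weight F x i.cons = x 0 * weight F (Fin.tail x) i ^ Fintype.card F := by
  rw [weight, Fin.prod_univ_succ, weight, ← Finset.prod_pow]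
  simp only [Idx.cons, Fin.cons_zero, Fin.cons_succ, pow_zero, pow_one, pow_succ, pow_mul,
    Fin.tail]

theorem weight_nonneg {x : Fin a → ℝ} (hx : ∀ k, 0 ≤ x k) (i : Idx a) : 0 ≤ weight F x i :=
  Finset.prod_nonneg fun k _ => pow_nonneg (hx k) _

/-- On tuples with `i_1 = 0` the weight is `x_0` times the `q`-th power of a tail weight. Division
by `x_0` is where the nonvanishing of `z_1, …, z_{d-1}` is needed. -/
theorem tendsto_weight_tail {x : Fin (a + 1) → ℝ} (hx : ∀ k, 0 ≤ x k) (h0 : x 0 ≠ 0)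
    (h : Tendsto (weight F x) cofinite (𝓝 0)) :
    Tendsto (weight F (Fin.tail x)) cofinite (𝓝 0) := by
  have h1 := (h.comp Idx.cons_injective.tendsto_cofinite).const_mul (x 0)⁻¹
  simp only [Function.comp_def, weight_cons, inv_mul_cancel_left₀ h0, mul_zero] at h1
  refine tendsto_order.mpr ⟨fun b hb => .of_forall fun i =>
    hb.trans_le (weight_nonneg (fun k => hx _) i), fun b hb => ?_⟩
  refine (h1.eventually (gt_mem_nhds (pow_pos hb (Fintype.card F)))).mono fun i hi => ?_
  exact lt_of_pow_lt_pow_left₀ _ hb.le hi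

theorem tendsto_weight_lastN {M : ℕ} {x : Fin M → ℝ} (hx : ∀ k, 0 ≤ x k)
    (h0 : ∀ k : Fin M, (k : ℕ) + 1 < M → x k ≠ 0) (h : Tendsto (weight F x) cofinite (𝓝 0))
    {b : ℕ} (hb : b + 1 ≤ M) : Tendsto (weight F (lastN hb x)) cofinite (𝓝 0) := by
  suffices H : ∀ r b, ∀ hb : b + 1 ≤ M, b + 1 + r = M →
      Tendsto (weight F (lastN hb x)) cofinite (𝓝 0) from H (M - (b + 1)) b hb (by omega)
  intro r
  induction r with
  | zero =>
    rintro b hb rfl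
    convert h using 2
    exact funext fun l => congrArg x (Fin.ext (by simp))
  | succ r ih =>
    intro b hb hr
    have h1 := ih (b + 1) (by omega) (by omega)
    have h2 := tendsto_weight_tail (x := lastN _ x) (fun k => hx _) (h0 _ (by simp; omega)) h1
    rwa [tail_lastN] at h2

end Weight

section SeriesTerm

variable {a : ℕ}

/-- The general term `∏_k Z_k^{(i_k)}` of the deformed series. -/
def seriesTerm (Z : Fin a → (CInf F)⟦X⟧) (i : Idx a) : (CInf F)⟦X⟧ :=
  ∏ k, twist^[i.1 k] (Z k)

theorem seriesTerm_shift (Z : Fin a → (CInf F)⟦X⟧) (i : Idx a) :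
    seriesTerm Z i.shift = twist (seriesTerm Z i) := by
  rw [seriesTerm, seriesTerm, twist_eq_map, map_prod]
  refine Finset.prod_congr rfl fun k _ => ?_
  rw [← twist_eq_map]
  exact Function.iterate_succ_apply' _ _ _

theorem seriesTerm_cons (Z : Fin (a + 1) → (CInf F)⟦X⟧) (i : Idx a) :
    seriesTerm Z i.cons = Z 0 * twist (seriesTerm (Fin.tail Z) i) := by
  rw [← seriesTerm_shift, seriesTerm, Fin.prod_univ_succ]
  rfl

open scoped PowerSeries.WithPiTopology in
-- Twisting `S` shifts all indices by one, so `S - S^{(1)}` retains exactly the tuples with `i_1 =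
-- 0`; these factor as `Z_1` times the twisted series in the remaining coefficients.
theorem sub_twist_eq_of_hasSum {Z : Fin (a + 1) → (CInf F)⟦X⟧} {S T : (CInf F)⟦X⟧}
    (hS : HasSum (seriesTerm Z) S) (hT : HasSum (seriesTerm (Fin.tail Z)) T) :
    S - twist S = Z 0 * twist T := by
  have h1 : HasSum (seriesTerm Z ∘ Idx.shift) (twist S) := by
    simp only [Function.comp_def, seriesTerm_shift, twist_eq_map]
    exact hS.map (PowerSeries.map (frob F)) continuous_twist
  have h2 : HasSum (seriesTerm Z ∘ Idx.cons) (Z 0 * twist T) := by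
    simp only [Function.comp_def, seriesTerm_cons, twist_eq_map]
    exact (hT.map (PowerSeries.map (frob F)) continuous_twist).mul_left (Z 0)
  have h3 := HasSum.add_isCompl Idx.isCompl_range
    (Idx.cons_injective.hasSum_range_iff.mpr h2) (Idx.shift_injective.hasSum_range_iff.mpr h1)
  exact sub_eq_iff_eq_add.mpr (hS.unique h3)

end SeriesTerm

theorem summable_prod_of_isUltrametricDist {ι κ E : Type*} [NormedAddCommGroup E]
    [IsUltrametricDist E] [CompleteSpace E] {f : ι × κ → E} {w : ι → ℝ}
    (hw : Tendsto w cofinite (𝓝 0)) (hf : ∀ i k, ‖f (i, k)‖ ≤ w i)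
    (hs : ∀ i, Summable fun k => f (i, k)) : Summable f := by
  refine NonarchimedeanAddGroup.summable_of_tendsto_cofinite_zero ?_
  rw [tendsto_zero_iff_norm_tendsto_zero]
  refine tendsto_order.mpr ⟨fun b hb => .of_forall fun x => hb.trans_le (norm_nonneg _),
    fun b hb => ?_⟩
  rw [eventually_cofinite]
  have h1 := eventually_cofinite.mp (hw.eventually (gt_mem_nhds hb))
  have h2 : ∀ i, {k | ¬ ‖f (i, k)‖ < b}.Finite := fun i => by
    have := (hs i).tendsto_cofinite_zero.norm
    rw [norm_zero] at this
    exact eventually_cofinite.mp (this.eventually (gt_mem_nhds hb))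
  refine (h1.biUnion fun i _ => (h2 i).image (Prod.mk i)).subset ?_
  rintro ⟨i, k⟩ hik
  refine Set.mem_biUnion (x := i) (fun hi => hik ((hf i k).trans_lt hi)) ?_
  exact ⟨k, hik, rfl⟩

/-- Bounds uniform in `d` that tend to `0` along `ι` make the double family summable, so the sum
over `ι` commutes with evaluation at `x`. -/
theorem hasSum_tsum_mul_pow {ι K : Type*} [NormedField K] [IsUltrametricDist K] [CompleteSpace K]
    {c : ι → ℕ → K} {w : ι → ℝ} {x : K} (hx : x ≠ 0) (hw : Tendsto w cofinite (𝓝 0))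
    (hc : ∀ i d, ‖c i d‖ * ‖x‖ ^ d ≤ w i) {v : ι → K}
    (hv : ∀ i, HasSum (fun d => c i d * x ^ d) (v i)) :
    (∀ d, Summable fun i => c i d) ∧ HasSum (fun d => (∑' i, c i d) * x ^ d) (∑' i, v i) := by
  have hs : Summable fun p : ι × ℕ => c p.1 p.2 * x ^ p.2 := by
    refine summable_prod_of_isUltrametricDist hw (fun i d => ?_) fun i => (hv i).summable
    rw [norm_mul, norm_pow]
    exact hc i d
  have h1 : ∀ d, Summable fun i => c i d := fun d =>
    (summable_mul_right_iff (pow_ne_zero d hx)).mp (hs.prod_symm.prod_factor d)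
  have h2 : ∑' p : ι × ℕ, c p.1 p.2 * x ^ p.2 = ∑' i, v i :=
    (hs.tsum_prod' fun i => (hv i).summable).trans (tsum_congr fun i => (hv i).tsum_eq)
  have h3 : HasSum (fun p : ℕ × ι => c p.2 p.1 * x ^ p.1) (∑' i, v i) := by
    rw [← h2]
    exact (Equiv.prodComm ℕ ι).hasSum_iff (f := fun p : ι × ℕ => c p.1 p.2 * x ^ p.2).mpr hs.hasSum
  exact ⟨h1, h3.prod_fiberwise fun d => (h1 d).hasSum.mul_right (x ^ d)⟩

/-! ### Polylogarithms as values at `t = θ` of the deformed series -/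

section Comparison

variable {a : ℕ} {ξ : CInf F} {n : Fin a → ℕ} {z : Fin a → CInf F}

/-- The number `|z_k| / |θ|^{q n_k/(q-1)}`. -/
def relNorm (ξ : CInf F) (n : Fin a → ℕ) (z : Fin a → CInf F) (k : Fin a) : ℝ :=
  ‖z k‖ / (‖ξ‖ ^ Fintype.card F) ^ n k

theorem relNorm_nonneg (k : Fin a) : 0 ≤ relNorm ξ n z k := by
  rw [relNorm]
  positivity

theorem norm_cmplTerm (hξ : ξ ^ (Fintype.card F - 1) = -theta F) (i : Idx a) :
    ‖cmplTerm n z i‖ = weight F (relNorm ξ n z) i * ∏ k, (‖ξ‖ ^ Fintype.card F) ^ n k := by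
  rw [cmplTerm, weight, norm_prod, ← Finset.prod_mul_distrib]
  refine Finset.prod_congr rfl fun k _ => ?_
  have h0 : ‖ξ‖ ≠ 0 := norm_ne_zero_iff.mpr (ne_zero_of_pow_eq hξ)
  have h1 := norm_L hξ (i.1 k)
  have h2 : ‖L F (i.1 k)‖ ≠ 0 := norm_ne_zero_iff.mpr (L_ne_zero _)
  have h3 : ((‖ξ‖ ^ Fintype.card F) ^ n k) ^ Fintype.card F ^ i.1 k =
      ‖L F (i.1 k)‖ ^ n k * (‖ξ‖ ^ Fintype.card F) ^ n k := by
    rw [← mul_pow, h1, ← pow_mul, ← pow_mul, ← pow_mul, pow_succ]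
    congr 1
    ring
  rw [norm_div, norm_pow, norm_pow, relNorm, div_pow, h3]
  field_simp

theorem summable_cmplTerm_iff (hξ : ξ ^ (Fintype.card F - 1) = -theta F) :
    Summable (cmplTerm n z) ↔ Tendsto (weight F (relNorm ξ n z)) cofinite (𝓝 0) := by
  have h0 : ∏ k, (‖ξ‖ ^ Fintype.card F) ^ n k ≠ 0 := Finset.prod_ne_zero_iff.mpr fun k _ =>
    pow_ne_zero _ (pow_ne_zero _ (norm_ne_zero_iff.mpr (ne_zero_of_pow_eq hξ)))
  rw [NonarchimedeanAddGroup.summable_iff_tendsto_cofinite_zero,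
    tendsto_zero_iff_norm_tendsto_zero]
  simp only [norm_cmplTerm hξ]
  constructor
  · intro h
    simpa only [mul_inv_cancel_right₀ h0, zero_mul] using
      h.mul_const (∏ k, (‖ξ‖ ^ Fintype.card F) ^ n k)⁻¹
  · intro h
    simpa only [zero_mul] using h.mul_const (∏ k, (‖ξ‖ ^ Fintype.card F) ^ n k)

variable (ξ n z) in
/-- The coefficients `Ω^{n_k} z_k` of the system. -/
def systemCoeff (k : Fin a) : (CInf F)⟦X⟧ := Omega ξ ^ n k * PowerSeries.C (z k)

/-- The bound is the weight that also measures `cmplTerm`, so convergence at `t = θ` alone forces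
uniform convergence on `|t| ≤ |θ|`. -/
theorem gaussLE_seriesTerm (i : Idx a) :
    GaussLE ‖theta F‖ (weight F (relNorm ξ n z) i) (seriesTerm (systemCoeff ξ n z) i) := by
  have hr := one_lt_norm_theta (F := F).le
  refine GaussLE.prod (norm_nonneg _) fun k _ => GaussLE.twist_iterate hr ?_ _
  have h := (((gaussLE_Omega ξ).mono (norm_nonneg _) theta_lt_theta_pow.le).pow
    (norm_nonneg _) (n k)).mul (norm_nonneg _) (GaussLE.C (z k))
  rwa [inv_pow, inv_mul_eq_div] at h

theorem hasValueAtTheta_seriesTerm (hξ : ξ ^ (Fintype.card F - 1) = -theta F) (i : Idx a) :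
    HasValueAtTheta (seriesTerm (systemCoeff ξ n z) i)
      ((piTilde ξ)⁻¹ ^ (∑ k, n k) * cmplTerm n z i) := by
  have e : (piTilde ξ)⁻¹ ^ (∑ k, n k) * cmplTerm n z i =
      ∏ k, ((piTilde ξ)⁻¹ / L F (i.1 k)) ^ n k * z k ^ Fintype.card F ^ i.1 k := by
    rw [← Finset.prod_pow_eq_pow_sum, cmplTerm, ← Finset.prod_mul_distrib]
    refine Finset.prod_congr rfl fun k _ => ?_
    rw [div_pow]
    ring
  rw [e]
  refine HasValueAtTheta.prod fun k _ => ?_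
  rw [systemCoeff, twist_iterate_mul, twist_iterate_pow, twist_iterate_C]
  exact ((hasValueAtTheta_twist_iterate_Omega hξ _).pow _).mul (hasValueAtTheta_C _)

open scoped PowerSeries.WithPiTopology in
theorem exists_hasSum_seriesTerm (hξ : ξ ^ (Fintype.card F - 1) = -theta F)
    (h : Summable (cmplTerm n z)) :
    ∃ S, HasSum (seriesTerm (systemCoeff ξ n z)) S ∧
      HasValueAtTheta S ((piTilde ξ)⁻¹ ^ (∑ k, n k) * cmpl n z) := by
  obtain ⟨h1, h2⟩ := hasSum_tsum_mul_pow theta_ne_zero ((summable_cmplTerm_iff hξ).mp h)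
    (c := fun i d => PowerSeries.coeff d (seriesTerm (systemCoeff ξ n z) i))
    (fun i => gaussLE_seriesTerm i) fun i => hasValueAtTheta_seriesTerm hξ i
  refine ⟨PowerSeries.mk fun d => ∑' i, PowerSeries.coeff d (seriesTerm (systemCoeff ξ n z) i),
    ?_, ?_⟩
  · refine (PowerSeries.WithPiTopology.hasSum_iff_hasSum_coeff _).mpr fun d => ?_
    rw [PowerSeries.coeff_mk]
    exact (h1 d).hasSum
  · rw [h.tsum_mul_left] at h2
    simpa only [HasValueAtTheta, PowerSeries.coeff_mk, cmpl] using h2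

open scoped PowerSeries.WithPiTopology in
theorem hasSum_seriesTerm_zero (Z : Fin 0 → (CInf F)⟦X⟧) : HasSum (seriesTerm Z) 1 := by
  have h := hasSum_single (f := seriesTerm Z) ⟨Fin.elim0, fun k => Fin.elim0 k⟩
    fun i hi => absurd (Subsingleton.elim (α := Idx 0) _ _) hi
  simpa [seriesTerm] using h

end Comparison

/-- The first sum is the exponent of `π̃` in `cmplVec`: the part of `N` not absorbed by the shorter
polylogarithm. -/
theorem sum_eq_sum_add_sum_lastEntries {m : ℕ} (n : Fin (m + 1) → ℕ) (j : Fin (m + 1)) :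
    ∑ i, n i = (∑ i : Fin (m + 1), if (i : ℕ) + j < m then n i else 0) +
      ∑ l, lastEntries j n l := by
  have h : ∑ l, lastEntries j n l = ∑ i : Fin (m + 1), if (i : ℕ) + j < m then 0 else n i := by
    refine Fintype.sum_of_injective (fun l : Fin (j + 1) => (⟨m - j + l, by omega⟩ : Fin (m + 1)))
      (fun k l hkl => ?_) _ _ (fun i hi => ?_) fun l => ?_
    · have := congrArg Fin.val hkl
      exact Fin.ext (by simp at this; omega)
    · refine if_pos (not_le.mp fun hle => hi ⟨⟨i + j - m, by omega⟩, Fin.ext (by simp; omega)⟩)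
    · rw [if_neg (by simp; omega)]
      rfl
  rw [h, ← Finset.sum_add_distrib]
  exact Finset.sum_congr rfl fun i _ => by split_ifs <;> simp

section BranchSeries

variable {ξ : CInf F} {m : ℕ} {n : Fin (m + 1) → ℕ} {z : Fin (m + 1) → CInf F}

open scoped PowerSeries.WithPiTopology in
/-- Where the series converge, they form a branch of the continued polylogarithm. -/
theorem isBranchValue_cmplVec (hξ : ξ ^ (Fintype.card F - 1) = -theta F)
    (h : ∀ j, Summable (cmplTerm (lastEntries j n) (lastEntries j z))) :
    IsBranchValue ξ n z (cmplVec ξ n z) := by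
  have h0 := ne_zero_of_pow_eq hξ
  have hS : ∀ b : Fin (m + 2), ∃ S,
      HasSum (seriesTerm (systemCoeff ξ (lastN (Nat.le_of_lt_succ b.2) n)
        (lastN (Nat.le_of_lt_succ b.2) z))) S ∧
      HasValueAtTheta S ((piTilde ξ)⁻¹ ^ (∑ k, lastN (Nat.le_of_lt_succ b.2) n k) *
        cmpl (lastN (Nat.le_of_lt_succ b.2) n) (lastN (Nat.le_of_lt_succ b.2) z)) := fun b => by
    refine exists_hasSum_seriesTerm hξ ?_
    -- The case `b = 0` is the series over the single empty tuple, which gives `f_0 = 1`.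
    refine Fin.cases ?_ (fun j => ?_) b
    · exact summable_of_hasFiniteSupport (Set.toFinite (α := Idx 0) _)
    · have := h j
      rw [lastEntries_eq_lastN, lastEntries_eq_lastN] at this
      exact this
  choose S hS hSv using hS
  refine ⟨S, ⟨(hS 0).unique (hasSum_seriesTerm_zero _),
    fun i => ⟨inTate_of_isRestricted (hSv _).isRestricted, ?_⟩⟩, fun j => ?_⟩
  · have h2 : HasSum (seriesTerm (systemCoeff ξ
        (Fin.tail (lastN (Nat.le_of_lt_succ i.succ.2) n))
        (Fin.tail (lastN (Nat.le_of_lt_succ i.succ.2) z)))) (S i.castSucc) := by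
      have h3 := hS i.castSucc
      rw [tail_lastN, tail_lastN]
      exact h3
    refine (sub_twist_eq_of_hasSum (hS i.succ) h2).trans ?_
    have e : (⟨m + 1 - (i + 1) + 0, by omega⟩ : Fin (m + 1)) = i.rev := by
      refine Fin.ext ?_
      simp only [Fin.val_rev, add_zero]
    exact congrArg (fun k => systemCoeff ξ n z k * twist (S i.castSucc)) e
  · rw [hasValueAtTheta_inv_Omega_pow_mul_iff h0]
    have h1 := hSv j.succ
    have e : (piTilde ξ)⁻¹ ^ (∑ i, n i) * cmplVec ξ n z j =
        (piTilde ξ)⁻¹ ^ (∑ l, lastEntries j n l) * cmpl (lastEntries j n) (lastEntries j z) := by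
      rw [cmplVec, sum_eq_sum_add_sum_lastEntries n j, pow_add, mul_mul_mul_comm, ← mul_pow,
        inv_mul_cancel₀ (piTilde_ne_zero h0), one_pow, one_mul]
    rw [e, lastEntries_eq_lastN, lastEntries_eq_lastN]
    exact h1

end BranchSeries

/-! ### The region `𝔻` -/

section Region

variable {ξ : CInf F} {m : ℕ} {n : Fin (m + 1) → ℕ}

theorem norm_theta_rpow (hξ : ξ ^ (Fintype.card F - 1) = -theta F) (n : ℕ) :
    ‖theta F‖ ^ ((Fintype.card F * n : ℝ) / (Fintype.card F - 1 : ℝ)) =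
      (‖ξ‖ ^ Fintype.card F) ^ n := by
  have h1 : (1 : ℝ) < Fintype.card F := by exact_mod_cast Fintype.one_lt_card (α := F)
  have h2 : ((Fintype.card F - 1 : ℕ) : ℝ) = Fintype.card F - 1 := by
    rw [Nat.cast_sub Fintype.card_pos, Nat.cast_one]
  rw [← norm_pow_card_sub_one hξ, ← Real.rpow_natCast, ← Real.rpow_mul (norm_nonneg _), h2,
    mul_div_cancel₀ _ (sub_pos.mpr h1).ne', ← pow_mul, ← Real.rpow_natCast, Nat.cast_mul]

theorem mem_regionD_iff (hξ : ξ ^ (Fintype.card F - 1) = -theta F) (z : Fin (m + 1) → CInf F) :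
    z ∈ regionD n ↔ Tendsto (weight F (relNorm ξ n z)) cofinite (𝓝 0) := by
  rw [regionD, Set.mem_ofPred_eq, Idx.comap_last_atTop]
  simp only [norm_theta_rpow hξ]
  rfl

theorem summable_lastEntries (hξ : ξ ^ (Fintype.card F - 1) = -theta F) {z : Fin m → CInf F}
    (hz : ∀ i, z i ≠ 0) {w : CInf F}
    (h : Summable (cmplTerm n (Fin.snoc z w : Fin (m + 1) → CInf F))) (j : Fin (m + 1)) :
    Summable (cmplTerm (lastEntries j n)
      (lastEntries j (Fin.snoc z w : Fin (m + 1) → CInf F))) := by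
  rw [summable_cmplTerm_iff hξ] at h ⊢
  rw [lastEntries_eq_lastN, lastEntries_eq_lastN]
  refine tendsto_weight_lastN (fun k => relNorm_nonneg k) (fun k hk => ?_) h
    (Nat.succ_le_of_lt j.2)
  obtain ⟨k, rfl⟩ : ∃ l : Fin m, k = l.castSucc := ⟨⟨k, by omega⟩, rfl⟩
  rw [relNorm, Fin.snoc_castSucc]
  exact div_ne_zero (norm_ne_zero_iff.mpr (hz k)) (pow_ne_zero _ (pow_ne_zero _
    (norm_ne_zero_iff.mpr (ne_zero_of_pow_eq hξ))))

end Region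

/-! ### Rigid analytic functions -/

theorem exists_ne_zero_norm_lt {ε : ℝ} (hε : 0 < ε) : ∃ ρ : CInf F, ρ ≠ 0 ∧ ‖ρ‖ < ε := by
  obtain ⟨k, hk⟩ := exists_pow_lt_of_lt_one hε (inv_lt_one_of_one_lt₀ (one_lt_norm_theta (F := F)))
  exact ⟨(theta F)⁻¹ ^ k, pow_ne_zero _ (inv_ne_zero theta_ne_zero), by
    rwa [norm_pow, norm_inv]⟩

theorem summable_of_norm_le_norm {ι : Type*} {f g : ι → CInf F} (hg : Summable g)
    (h : ∀ i, ‖f i‖ ≤ ‖g i‖) : Summable f :=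
  NonarchimedeanAddGroup.summable_of_tendsto_cofinite_zero
    (squeeze_zero_norm h (tendsto_zero_iff_norm_tendsto_zero.mp hg.tendsto_cofinite_zero))

/-- A family of monomials that is summable on a disk sums to a rigid analytic function. -/
theorem isRigidAnalyticOnDisk_tsum {ι : Type*} {b : ι → CInf F} {e : ι → ℕ} {ρ : CInf F}
    (hρ : ρ ≠ 0) (hs : Summable fun i => b i * ρ ^ e i) :
    IsRigidAnalyticOnDisk (fun y => ∑' i, b i * y ^ e i) 0 ‖ρ‖ := by
  have hfib : ∀ k, Summable fun i : {i // e i = k} => b i := fun k => by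
    refine (summable_mul_right_iff (pow_ne_zero k hρ)).mp ?_
    refine (hs.comp_injective (Subtype.val_injective (p := fun i => e i = k))).congr fun i => ?_
    rw [Function.comp_apply, i.2]
  have key : ∀ y : CInf F, ‖y‖ ≤ ‖ρ‖ →
      HasSum (fun k => (∑' i : {i // e i = k}, b i) * y ^ k) (∑' i, b i * y ^ e i) := by
    intro y hy
    have h1 : Summable fun i => b i * y ^ e i := summable_of_norm_le_norm hs fun i => by
      rw [norm_mul, norm_mul, norm_pow, norm_pow]
      gcongr
    have h2 : HasSum (fun p : Σ k, {i // e i = k} => b p.2 * y ^ e p.2) (∑' i, b i * y ^ e i) :=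
      -- Grouping the monomials by exponent produces the coefficients of the power series.
      (Equiv.sigmaFiberEquiv e).hasSum_iff (f := fun i => b i * y ^ e i) |>.mpr h1.hasSum
    refine h2.sigma fun k => ?_
    have h3 := (hfib k).hasSum.mul_right (y ^ k)
    have h4 : (fun i : {i // e i = k} => b i * y ^ k) =
        fun i : {i // e i = k} => b i * y ^ e i := by
      ext i
      rw [i.2]
    rwa [h4] at h3
  refine ⟨fun k => ∑' i : {i // e i = k}, b i, ?_, fun y hy => ?_⟩
  · have h := (key ρ le_rfl).summable.tendsto_cofinite_zero.norm
    rw [Nat.cofinite_eq_atTop, norm_zero] at h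
    simpa only [norm_mul, norm_pow] using h
  · rw [sub_zero]
    exact key y (mem_closedBall_zero_iff.mp hy)

theorem IsRigidAnalyticOnDisk.const_add_const_mul_comp_sub {ψ : CInf F → CInf F} {r : ℝ}
    (h : IsRigidAnalyticOnDisk ψ 0 r) (x₀ v c : CInf F) :
    IsRigidAnalyticOnDisk (fun x => v + c * ψ (x - x₀)) x₀ r := by
  obtain ⟨a, ha, hs⟩ := h
  refine ⟨fun k => (if k = 0 then v else 0) + c * a k, ?_, fun x hx => ?_⟩
  · have h1 := ha.const_mul ‖c‖
    rw [mul_zero] at h1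
    refine h1.congr' ((eventually_gt_atTop 0).mono fun k hk => ?_)
    simp only
    rw [if_neg hk.ne', zero_add, norm_mul, mul_assoc]
  · have h1 := hs (x - x₀) (by simpa [dist_eq_norm] using hx)
    have h2 : HasSum (fun k => if k = 0 then v else 0) v := by
      simpa using hasSum_ite_eq (0 : ℕ) v
    have h3 := h2.add (h1.mul_left c)
    have e : (fun k => ((if k = 0 then v else 0) + c * a k) * (x - x₀) ^ k) =
        fun k => (if k = 0 then v else 0) + c * (a k * (x - x₀ - 0) ^ k) :=
      _root_.funext fun k => by
        rw [sub_zero]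
        rcases eq_or_ne k 0 with rfl | hk
        · simp
        · rw [if_neg hk]
          ring
    rw [e]
    exact h3

/-! ### Dependence on the last variable near `0` -/

section LastVariable

variable {a : ℕ} {n : Fin (a + 1) → ℕ} {u : Fin a → CInf F}

theorem cmplTerm_snoc (y : CInf F) (i : Idx (a + 1)) :
    cmplTerm n (Fin.snoc u y : Fin (a + 1) → CInf F) i =
      cmplTerm n (Fin.snoc u 1 : Fin (a + 1) → CInf F) i *
        y ^ Fintype.card F ^ i.1 (Fin.last a) := by
  rw [cmplTerm, cmplTerm, Fin.prod_univ_castSucc, Fin.prod_univ_castSucc]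
  simp only [Fin.snoc_castSucc, Fin.snoc_last]
  rw [one_pow]
  ring

/-- Since `|L_i| ≥ 1`, the denominators can be dropped; replacing `|u_k|` by `max 1 |u_k|` lets
every exponent grow to that of the last index. -/
theorem norm_cmplTerm_snoc_one_le (i : Idx (a + 1)) :
    ‖cmplTerm n (Fin.snoc u 1 : Fin (a + 1) → CInf F) i‖ ≤
      (∏ k, max 1 ‖u k‖) ^ Fintype.card F ^ i.1 (Fin.last a) := by
  have hL : ∀ k, 1 ≤ ‖L F (i.1 k) ^ n k‖ := fun k => by
    rw [norm_pow]
    exact one_le_pow₀ (one_le_norm_L _)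
  rw [cmplTerm, norm_prod, Fin.prod_univ_castSucc, ← Finset.prod_pow]
  simp only [Fin.snoc_castSucc, Fin.snoc_last]
  refine (mul_le_of_le_one_right (by positivity) ?_).trans
    (Finset.prod_le_prod (fun k _ => norm_nonneg _) fun k _ => ?_)
  · rw [norm_div, one_pow, norm_one]
    exact div_le_one_of_le₀ (hL _) (norm_nonneg _)
  · rw [norm_div, norm_pow]
    refine (div_le_self (by positivity) (hL _)).trans ?_
    calc ‖u k‖ ^ Fintype.card F ^ i.1 k.castSucc
        ≤ max 1 ‖u k‖ ^ Fintype.card F ^ i.1 k.castSucc := by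
          gcongr
          exact le_max_right _ _
      _ ≤ _ := pow_le_pow_right₀ (le_max_left _ _)
          (Nat.pow_le_pow_right Fintype.card_pos (i.2.monotone (Fin.le_last _)))

/-- For `z_d` close to `0` the series converges to a small value, rigid analytic in `z_d`. -/
theorem exists_disk_cmpl_snoc (n : Fin (a + 1) → ℕ) (u : Fin a → CInf F) {η : ℝ} (hη : 0 < η) :
    ∃ δ > 0, ∀ ρ : CInf F, ρ ≠ 0 → ‖ρ‖ < δ →
      (∀ y : CInf F, ‖y‖ ≤ ‖ρ‖ →
        Summable (cmplTerm n (Fin.snoc u y : Fin (a + 1) → CInf F)) ∧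
        ‖cmpl n (Fin.snoc u y : Fin (a + 1) → CInf F)‖ ≤ η) ∧
      IsRigidAnalyticOnDisk (fun y => cmpl n (Fin.snoc u y : Fin (a + 1) → CInf F)) 0 ‖ρ‖ := by
  have hB : 0 < ∏ k, max 1 ‖u k‖ :=
    Finset.prod_pos fun k _ => one_pos.trans_le (le_max_left _ _)
  -- With this radius `|ρ| ∏ max 1 |u_k|` is below `1`, which gives convergence, and below `η`,
  -- which bounds each term.
  refine ⟨min 1 η / ∏ k, max 1 ‖u k‖, by positivity, fun ρ hρ hlt => ?_⟩
  rw [lt_div_iff₀ hB, lt_min_iff] at hlt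
  obtain ⟨h1, hη'⟩ := hlt
  have h0 : 0 ≤ ‖ρ‖ * ∏ k, max 1 ‖u k‖ := by positivity
  have hle : ∀ i : Idx (a + 1), ‖cmplTerm n (Fin.snoc u ρ : Fin (a + 1) → CInf F) i‖ ≤
      (‖ρ‖ * ∏ k, max 1 ‖u k‖) ^ Fintype.card F ^ i.1 (Fin.last a) := fun i => by
    rw [cmplTerm_snoc, norm_mul, norm_pow, mul_pow, mul_comm]
    gcongr
    exact norm_cmplTerm_snoc_one_le i
  have hs : Summable (cmplTerm n (Fin.snoc u ρ : Fin (a + 1) → CInf F)) := by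
    refine NonarchimedeanAddGroup.summable_of_tendsto_cofinite_zero ?_
    refine squeeze_zero_norm hle ?_
    rw [← Idx.comap_last_atTop]
    exact ((tendsto_pow_atTop_nhds_zero_of_lt_one h0 h1).comp
      (tendsto_pow_atTop_atTop_of_one_lt Fintype.one_lt_card)).comp tendsto_comap
  have hyle : ∀ y : CInf F, ‖y‖ ≤ ‖ρ‖ → ∀ i : Idx (a + 1),
      ‖cmplTerm n (Fin.snoc u y : Fin (a + 1) → CInf F) i‖ ≤
        ‖cmplTerm n (Fin.snoc u ρ : Fin (a + 1) → CInf F) i‖ := fun y hy i => by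
    rw [cmplTerm_snoc, cmplTerm_snoc ρ, norm_mul, norm_mul, norm_pow, norm_pow]
    gcongr
  refine ⟨fun y hy => ⟨summable_of_norm_le_norm hs (hyle y hy), ?_⟩, ?_⟩
  · refine IsUltrametricDist.norm_tsum_le_of_forall_le_of_nonneg hη.le fun i => ?_
    refine ((hyle y hy i).trans (hle i)).trans (le_trans ?_ hη'.le)
    exact pow_le_of_le_one h0 h1.le (pow_pos Fintype.card_pos _).ne'
  · have h := isRigidAnalyticOnDisk_tsum (b := cmplTerm n (Fin.snoc u 1 : Fin (a + 1) → CInf F))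
      (e := fun i => Fintype.card F ^ i.1 (Fin.last a)) hρ
      (hs.congr fun i => cmplTerm_snoc ρ i)
    have e : (fun y => cmpl n (Fin.snoc u y : Fin (a + 1) → CInf F)) = fun y =>
        ∑' i, cmplTerm n (Fin.snoc u 1 : Fin (a + 1) → CInf F) i *
          y ^ Fintype.card F ^ i.1 (Fin.last a) :=
      _root_.funext fun y => tsum_congr fun i => cmplTerm_snoc y i
    rw [e]
    exact h

end LastVariable

theorem lastEntries_snoc {α : Type*} {m : ℕ} (j : Fin (m + 1)) (z : Fin m → α) (y : α) :
    lastEntries j (Fin.snoc z y : Fin (m + 1) → α) =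
      (Fin.snoc (fun l : Fin j => z ⟨m - j + l, by omega⟩) y : Fin (j + 1) → α) := by
  funext l
  refine Fin.lastCases ?_ (fun l => ?_) l
  · have e : (⟨m - j + Fin.last (j : ℕ), by simp; omega⟩ : Fin (m + 1)) = Fin.last m :=
      Fin.ext (by simp; omega)
    rw [Fin.snoc_last]
    exact (congrArg (Fin.snoc z y : Fin (m + 1) → α) e).trans
      (Fin.snoc_last (α := fun _ => α) y z)
  · rw [Fin.snoc_castSucc]
    exact Fin.snoc_castSucc (α := fun _ => α) y z ⟨m - j + l, by omega⟩

/-! ### Local analyticity -/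

section Local

variable {ξ : CInf F} {m : ℕ} {n : Fin (m + 1) → ℕ} {z : Fin m → CInf F}

theorem isLocallyRigidAnalytic_contCMPL (hξ : ξ ^ (Fintype.card F - 1) = -theta F) :
    IsLocallyRigidAnalytic (monodromy ξ n z) (contCMPL ξ n z) := by
  intro x₀
  have h0 := ne_zero_of_pow_eq hξ
  have hpi := piTilde_ne_zero h0
  obtain ⟨v₀, hv₀, -⟩ := isBranchValue_epsilon (n := n) (z := z) h0 x₀
  obtain ⟨ε, hε, hM⟩ := exists_norm_lt_eq_zero_of_mem_monodromy (n := n) (z := z) h0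
  -- Two points of the polydisk then differ by less than `ε`, so they coincide if congruent modulo
  -- `M`.
  obtain ⟨σ, hσ0, hσ⟩ := exists_ne_zero_norm_lt (F := F) (half_pos hε)
  let c : Fin (m + 1) → CInf F := fun j =>
    piTilde ξ ^ (∑ i : Fin (m + 1), if (i : ℕ) + j < m then n i else 0)
  have hc : ∀ j, 0 < ‖c j‖ := fun j => norm_pos_iff.mpr (pow_ne_zero _ hpi)
  have hδ := fun j : Fin (m + 1) => exists_disk_cmpl_snoc (lastEntries j n)
    (fun l : Fin j => z ⟨m - j + l, by omega⟩)
    (div_pos (norm_pos_iff.mpr hσ0) (hc j))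
  simp only [← lastEntries_snoc] at hδ
  choose δ hδ0 hδ using hδ
  -- The smallest of the `δ j` provides one disk that works for all coordinates.
  obtain ⟨j₀, hj₀⟩ := Finite.exists_min δ
  obtain ⟨ρ, hρ0, hρ⟩ := exists_ne_zero_norm_lt (F := F) (hδ0 j₀)
  have hloc := fun j => hδ j ρ hρ0 (hρ.trans_le (hj₀ j))
  refine ⟨ρ, σ, v₀, hρ0, hσ0, fun x hx y hy hxy => ?_,
    fun x => v₀ + cmplVec ξ n (Fin.snoc z (x - x₀) : Fin (m + 1) → CInf F), fun x hx => ⟨?_, ?_⟩,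
    fun j => ?_⟩
  · refine sub_eq_zero.mp (hM _ ((Submodule.Quotient.eq _).mp hxy) ?_)
    rw [← dist_eq_norm]
    have h1 := dist_triangle_right x y v₀
    have h2 := Metric.mem_closedBall.mp hx
    have h3 := Metric.mem_closedBall.mp hy
    linarith
  · rw [Metric.mem_closedBall, dist_eq_norm, add_sub_cancel_left]
    rw [pi_norm_le_iff_of_nonneg (norm_nonneg _)]
    intro j
    rw [Metric.mem_closedBall, dist_eq_norm] at hx
    have h1 := ((hloc j).1 (x - x₀) hx).2
    rw [le_div_iff₀ (hc j), mul_comm, ← norm_mul] at h1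
    exact h1
  · rw [Metric.mem_closedBall, dist_eq_norm] at hx
    -- The series at the small argument `x - x₀` is a branch there; adding the branch value `v₀` at
    -- `x₀` gives a branch at `x`.
    have h1 := isBranchValue_cmplVec hξ fun j => ((hloc j).1 (x - x₀) hx).1
    have h2 := hv₀.add h0 h1
    rw [add_sub_cancel] at h2
    exact (isBranchValue_iff_mk_eq_contCMPL h0 _ _).mp h2
  · exact (hloc j).2.const_add_const_mul_comp_sub x₀ (v₀ j) (c j)

end Local

end CarlitzMPL

end

theorem mainTheorem6 {F : Type*} [Field F] [Fintype F]
    (ξ : CarlitzMPL.CInf F)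
    (hξ : ξ ^ (Fintype.card F - 1) = -CarlitzMPL.CInf.theta F)
    (m : ℕ) (n : Fin (m + 1) → ℕ) (hn : ∀ i, 0 < n i)
    (z : Fin m → CarlitzMPL.CInf F) :
    -- the objects are well defined
    ((∀ g ∈ CarlitzMPL.tMonodromy ξ n z, ∀ j, ∃ v, CarlitzMPL.HasValueAtTheta (g j) v) ∧
      (∀ (w : CarlitzMPL.CInf F) (v : Fin (m + 1) → CarlitzMPL.CInf F),
        CarlitzMPL.IsBranchValue ξ n (Fin.snoc z w : Fin (m + 1) → CarlitzMPL.CInf F) v ↔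
          Submodule.Quotient.mk v = CarlitzMPL.contCMPL ξ n z w) ∧
      IsLinearMap F (CarlitzMPL.contCMPL ξ n z)) ∧
    -- comparison with the series
    (∀ w : CarlitzMPL.CInf F,
      (Fin.snoc z w : Fin (m + 1) → CarlitzMPL.CInf F) ∈ CarlitzMPL.regionD n →
        Summable (CarlitzMPL.cmplTerm n (Fin.snoc z w : Fin (m + 1) → CarlitzMPL.CInf F)) ∧
        ((∀ i, z i ≠ 0) → ∀ j, Summable (CarlitzMPL.cmplTerm (CarlitzMPL.lastEntries j n)
          (CarlitzMPL.lastEntries j (Fin.snoc z w : Fin (m + 1) → CarlitzMPL.CInf F)))) ∧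
        ((∀ j, Summable (CarlitzMPL.cmplTerm (CarlitzMPL.lastEntries j n)
          (CarlitzMPL.lastEntries j (Fin.snoc z w : Fin (m + 1) → CarlitzMPL.CInf F)))) →
          CarlitzMPL.contCMPL ξ n z w =
            Submodule.Quotient.mk
              (CarlitzMPL.cmplVec ξ n (Fin.snoc z w : Fin (m + 1) → CarlitzMPL.CInf F)))) ∧
    -- local rigid analyticity
    CarlitzMPL.IsLocallyRigidAnalytic (CarlitzMPL.monodromy ξ n z) (CarlitzMPL.contCMPL ξ n z) ∧
    -- discreteness of the monodromy module
    DiscreteTopology (CarlitzMPL.monodromy ξ n z) := by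
  have h0 := CarlitzMPL.ne_zero_of_pow_eq hξ
  refine ⟨⟨fun g hg => CarlitzMPL.exists_hasValueAtTheta_of_mem_tMonodromy hg,
    CarlitzMPL.isBranchValue_iff_mk_eq_contCMPL h0, CarlitzMPL.isLinearMap_contCMPL h0⟩,
    fun w hw => ?_, CarlitzMPL.isLocallyRigidAnalytic_contCMPL hξ,
    CarlitzMPL.discreteTopology_monodromy h0⟩
  have hs := (CarlitzMPL.summable_cmplTerm_iff hξ).mpr ((CarlitzMPL.mem_regionD_iff hξ _).mp hw)
  refine ⟨hs, fun hz => CarlitzMPL.summable_lastEntries hξ hz hs, fun h => ?_⟩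
  exact ((CarlitzMPL.isBranchValue_iff_mk_eq_contCMPL h0 _ _).mp
    (CarlitzMPL.isBranchValue_cmplVec hξ h)).symm
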